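/- All graphs are finite, with no loops and no multiple edges. For a graph $G$ with vertex set $V$ and adjacency matrix $A_G$, and for $X\subseteq V$, let $\operatorname{cutrk}_G(X)$ be the rank over $\mathrm{GF}(2)$ of the submatrix $A_G[X,V\setminus X]$. The width of an ordering $(x_1,\dots,x_n)$ of $V$ is $\max_{1\le i\le n}\operatorname{cutrk}_G(\{x_1,\dots,x_i\})$ (taken to be $0$ if $n=0$), and the linear rank-width of $G$ is the minimum width over all orderings of $V$. Let $K_3$ be the triangle, $C_5$ the cycle on five vertices, and $S_{1,2,2}$ the graph obtained from the claw $K_{1,3}$ by subdividing each of two of its three edges exactly once. A graph is $H$-free if it has no induced subgraph isomorphic to $H$, and $(H_1,H_2)$-free if it is both $H_1$-free and $H_2$-free. Theorem. Every $(K_3,S_{1,2,2})$-free graph $G$ has linear rank-width at most $58$. Moreover: (i) if $G$ is bipartite, then its linear rank-width is at most $3$; (ii) if $G$ is not bipartite and is $C_5$-free, then its linear rank-width is at most $3$. (Hence the bound $58$ is only needed when $G$ contains an induced $C_5$.) -/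

import Mathlib

namespace LinearRankWidth

/-- The cut-rank of a vertex set `X`: the rank over the binary field of the submatrix
`A_G[X, V \ X]` of the adjacency matrix. -/
noncomputable def cutRank {V : Type*} [Fintype V] (G : SimpleGraph V) (X : Finset V) : ℕ :=
  open Classical in
  ((G.adjMatrix (ZMod 2)).submatrix
    (fun x : {v : V // v ∈ X} => (x : V)) (fun y : {v : V // v ∉ X} => (y : V))).rank

/-- The set of the first vertices `x_1, …, x_i` of a linear ordering, where the ordering is given
by the bijection `e` that sends each vertex to its (zero-based) position. -/
def initialSegment {V : Type*} [Fintype V] (e : V ≃ Fin (Fintype.card V))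
    (i : Fin (Fintype.card V)) : Finset V :=
  Finset.univ.filter fun v => e v ≤ i

/-- The width of a linear ordering: the maximum of the cut-ranks of its nonempty initial segments
(and `0` for the graph without vertices). -/
noncomputable def orderingWidth {V : Type*} [Fintype V] (G : SimpleGraph V)
    (e : V ≃ Fin (Fintype.card V)) : ℕ :=
  Finset.univ.sup fun i => cutRank G (initialSegment e i)

/-- The linear rank-width: the minimum width over all linear orderings of the vertices. The set of
orderings is never empty, so the infimum is attained. -/
noncomputable def linearRankWidth {V : Type*} [Fintype V] (G : SimpleGraph V) : ℕ :=
  ⨅ e : V ≃ Fin (Fintype.card V), orderingWidth G e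

/-- `H` does not occur as an induced subgraph of `G`. -/
def InducedFree {W V : Type*} (H : SimpleGraph W) (G : SimpleGraph V) : Prop :=
  ¬ H.IsIndContained G

/-- The subdivided claw `S_{l 0, l 1, l 2}`: a centre `none` with three paths attached to it, the
`a`-th of which has the `l a` vertices `(a, 0), …, (a, l a - 1)`, where `(a, 0)` is adjacent to the
centre and `(a, p)` is adjacent to `(a, p + 1)`. For `l = ![1, 1, 1]` it is the claw, and each
further vertex of a path subdivides the corresponding edge once. -/
def subdividedClaw (l : Fin 3 → ℕ) : SimpleGraph (Option (Σ a : Fin 3, Fin (l a))) :=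
  SimpleGraph.fromRel fun u v =>
    match u, v with
    | none, some y => (y.2 : ℕ) = 0
    | some x, some y => x.1 = y.1 ∧ (y.2 : ℕ) = (x.2 : ℕ) + 1
    | _, none => False

end LinearRankWidth

namespace LinearRankWidth

/-! An ordering has small width as soon as, for every initial segment `X`, the rows of the cut
matrix fall into few classes, or the matrix is a sum of few rank-one products. Since an ordering can
be assembled from orderings of the components, `G` may be assumed connected. Nearly every structural
fact is then obtained by exhibiting a forbidden `S_{1,2,2}`.

Suppose first that there is no closed walk of length five. If there is an induced cycle of length at
least 7, each vertex imitates a vertex of the cycle, and substituting it into the cycle shows that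
`G` is a blow-up of that cycle; ordering by type gives width 3. If there is none, a shortest odd
closed walk would be such a cycle, so `G` is bipartite. Either the bipartite complement has no
induced path on five vertices with centre and ends in one class, so that its components are chain
graphs and can be swept one by one, again with width 3; or the resulting gap, two independent edges
and a vertex, produces an induced path on seven vertices, and `G` is a blow-up of a longest induced
path.

Suppose now that there is a five-cycle, chosen with maximal degree sum. It dominates `G`, and every
vertex is a clone of a cycle vertex or pendant at one. Refining this into 20 labels, adjacency
depends on labels only, except inside five blocks: pendants at `b` and the imperfectly joined clones
of `b + 2` and `b + 3`. A block carries an acyclic orientation such that, in a compatible ordering,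
equally labelled vertices have equal rows in each cut (`HasWidth.of_blocks`). This gives width 20;
the bound 58 is a weakening. -/

open Function

/-! ### Cuts, orderings and keys -/

/-- The adjacency across the cut `(X, V \ X)` is a sum of `k` products over the binary field. -/
def CutLE {V : Type*} (G : SimpleGraph V) (X : Set V) (k : ℕ) : Prop :=
  ∃ f g : Fin k → V → ZMod 2, ∀ x ∈ X, ∀ y ∉ X,
    (G.Adj x y → ∑ i, f i x * g i y = 1) ∧ (¬ G.Adj x y → ∑ i, f i x * g i y = 0)

theorem CutLE.mono {V : Type*} {G : SimpleGraph V} {X : Set V} {k l : ℕ} (h : CutLE G X k)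
    (hkl : k ≤ l) : CutLE G X l := by
  obtain ⟨m, rfl⟩ := Nat.exists_eq_add_of_le hkl
  obtain ⟨f, g, h⟩ := h
  refine ⟨Fin.append f fun _ _ => 0, Fin.append g fun _ _ => 0, fun x hx y hy => ?_⟩
  have := h x hx y hy
  simp_all [Fin.sum_univ_add]

theorem CutLE.cutRank_le {V : Type*} [Fintype V] {G : SimpleGraph V} {X : Finset V} {k : ℕ}
    (h : CutLE G X k) : cutRank G X ≤ k := by
  classical
  obtain ⟨f, g, h⟩ := h
  have key : (G.adjMatrix (ZMod 2)).submatrix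
      (fun x : {v : V // v ∈ X} => (x : V)) (fun y : {v : V // v ∉ X} => (y : V)) =
      (Matrix.of fun (x : {v : V // v ∈ X}) (i : Fin k) => f i x) *
        (Matrix.of fun (i : Fin k) (y : {v : V // v ∉ X}) => g i y) := by
    ext x y
    have := h x (by simpa using x.2) y (by simpa using y.2)
    simp only [Matrix.submatrix_apply, SimpleGraph.adjMatrix_apply, Matrix.mul_apply,
      Matrix.of_apply]
    split_ifs with hxy
    · exact (this.1 hxy).symm
    · exact (this.2 hxy).symm
  unfold cutRank
  calc _ = ((Matrix.of fun (x : {v : V // v ∈ X}) (i : Fin k) => f i x) *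
        (Matrix.of fun (i : Fin k) (y : {v : V // v ∉ X}) => g i y)).rank := by
        rw [← key]
    _ ≤ _ := (Matrix.rank_mul_le_left _ _).trans
      ((Matrix.rank_le_card_width _).trans (Fintype.card_fin k).le)

/-- If the nonzero rows of the cut matrix fall into `k` classes of equal rows, then its rank is at
most `k`. -/
theorem CutLE.of_types {V : Type*} {G : SimpleGraph V} {X : Set V} {k : ℕ} (τ : V → Option (Fin k))
    (h0 : ∀ x ∈ X, τ x = none → ∀ y ∉ X, ¬ G.Adj x y)
    (h1 : ∀ x ∈ X, ∀ x' ∈ X, τ x = τ x' → τ x ≠ none → ∀ y ∉ X, G.Adj x y → G.Adj x' y) :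
    CutLE G X k := by
  classical
  refine ⟨fun i x => if τ x = some i then 1 else 0,
    fun i y => if ∃ x ∈ X, τ x = some i ∧ G.Adj x y then 1 else 0, fun x hx y hy => ?_⟩
  rcases hτ : τ x with _ | i
  · have := h0 x hx hτ y hy
    simp [this, hτ]
  · have hi : (∃ x' ∈ X, τ x' = some i ∧ G.Adj x' y) ↔ G.Adj x y :=
      ⟨fun ⟨x', hx', e, ha⟩ => h1 x' hx' x hx (e.trans hτ.symm) (by simp [e]) y hy ha,
        fun ha => ⟨x, hx, hτ, ha⟩⟩
    simp only [hτ, Option.some.injEq, ite_mul, one_mul, zero_mul, Finset.sum_ite_eq,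
      Finset.mem_univ, if_true, hi]
    constructor <;> intro ha <;> simp [ha]

/-- There is a linear ordering all of whose initial segments have cuts of rank at most `k`. -/
def HasWidth {V : Type*} (G : SimpleGraph V) (k : ℕ) : Prop :=
  ∃ r : V → ℕ, Injective r ∧ ∀ t, CutLE G {v | r v < t} k

theorem HasWidth.mono {V : Type*} {G : SimpleGraph V} {k l : ℕ} (h : HasWidth G k)
    (hkl : k ≤ l) : HasWidth G l := by
  obtain ⟨r, hr, h⟩ := h
  exact ⟨r, hr, fun t => (h t).mono hkl⟩

theorem HasWidth.linearRankWidth_le {V : Type*} [Fintype V] {G : SimpleGraph V} {k : ℕ}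
    (h : HasWidth G k) : linearRankWidth G ≤ k := by
  classical
  obtain ⟨r, hr, h⟩ := h
  let _ : LinearOrder V := LinearOrder.lift' r hr
  let e := (Fintype.orderIsoFinOfCardEq V rfl).symm
  refine (ciInf_le (OrderBot.bddBelow _) e.toEquiv).trans ?_
  refine Finset.sup_le fun i _ => ?_
  apply CutLE.cutRank_le
  convert h (r (e.symm i) + 1) using 1
  ext v
  have : r v ≤ r (e.symm i) ↔ v ≤ e.symm i := Iff.rfl
  simp only [initialSegment, Finset.coe_filter, Finset.mem_univ, true_and, Set.mem_ofPred_eq,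
    Nat.lt_succ_iff, this]
  exact (OrderIso.le_symm_apply e).symm

/-- Ordering by `φ` with ties broken arbitrarily, an initial segment consists of all levels below
some `t` and a part of level `t`. The rank `e v + card V * φ v` encodes the lexicographic order. -/
theorem HasWidth.of_key {V : Type*} [Fintype V] {G : SimpleGraph V} {k : ℕ} (φ : V → ℕ)
    (h : ∀ (X : Set V) (t : ℕ), (∀ v, φ v < t → v ∈ X) → (∀ v ∈ X, φ v ≤ t) → CutLE G X k) :
    HasWidth G k := by
  classical
  let e := Fintype.equivFin V
  have hmod : ∀ v, ((e v : ℕ) + Fintype.card V * φ v) / Fintype.card V = φ v := fun v => by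
    rw [Nat.add_mul_div_left _ _ (by have := (e v).2; omega), Nat.div_eq_of_lt (e v).2, zero_add]
  refine ⟨fun v => e v + Fintype.card V * φ v, fun u v huv => ?_, fun t => ?_⟩
  · have h1 : φ u = φ v := by rw [← hmod u, ← hmod v]; exact congrArg (· / _) huv
    have : (e u : ℕ) + Fintype.card V * φ u = e v + Fintype.card V * φ v := huv
    rw [h1] at this
    exact e.injective (Fin.ext (by omega))
  · refine h _ (t / Fintype.card V) (fun v hv => ?_) fun v hv => ?_
    · by_contra hcon
      have : t ≤ (e v : ℕ) + Fintype.card V * φ v := not_lt.1 hcon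
      have := Nat.div_le_div_right (c := Fintype.card V) this
      rw [hmod] at this
      omega
    · have hv : (e v : ℕ) + Fintype.card V * φ v < t := hv
      have := Nat.div_le_div_right (c := Fintype.card V) hv.le
      rwa [hmod] at this

/-- The components are placed one after another. An initial segment then splits at most one of them,
the one with index `t / M`, and no edge joins two components. -/
theorem HasWidth.of_components {V : Type*} [Fintype V] {G : SimpleGraph V} {k : ℕ}
    (h : ∀ C : G.ConnectedComponent, HasWidth C.toSimpleGraph k) : HasWidth G k := by
  classical
  choose r hr hw using h
  let e := Fintype.equivFin G.ConnectedComponent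
  let ρ : V → ℕ := fun v => r (G.connectedComponentMk v) ⟨v, rfl⟩
  have hρ : ∀ (C : G.ConnectedComponent) (v : V) (hv : v ∈ C), ρ v = r C ⟨v, hv⟩ := by
    rintro C v rfl
    rfl
  have hρ' : ∀ v, ρ v < Finset.univ.sup ρ + 1 := fun v =>
    Nat.lt_succ_of_le (Finset.le_sup (f := ρ) (Finset.mem_univ v))
  set M := Finset.univ.sup ρ + 1 with hM
  let c : V → ℕ := fun v => e (G.connectedComponentMk v)
  have hdiv : ∀ v, (ρ v + M * c v) / M = c v := fun v => by
    rw [Nat.add_mul_div_left _ _ (by omega), Nat.div_eq_of_lt (hρ' v), zero_add]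
  have hmod : ∀ v, (ρ v + M * c v) % M = ρ v := fun v => by
    rw [Nat.add_mul_mod_self_left, Nat.mod_eq_of_lt (hρ' v)]
  have hc : ∀ {u v}, c u = c v → G.connectedComponentMk u = G.connectedComponentMk v :=
    fun huv => e.injective (Fin.ext huv)
  have hadj : ∀ {u v}, G.Adj u v → G.connectedComponentMk u = G.connectedComponentMk v :=
    fun huv => SimpleGraph.ConnectedComponent.sound huv.reachable
  refine ⟨fun v => ρ v + M * c v, fun u v huv => ?_, fun t => ?_⟩
  · have h1 : c u = c v := by rw [← hdiv u, ← hdiv v]; exact congrArg (· / M) huv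
    have h2 : ρ u = ρ v := by rw [← hmod u, ← hmod v]; exact congrArg (· % M) huv
    have h3 := hc h1
    rw [hρ _ u h3, hρ _ v rfl] at h2
    exact congrArg Subtype.val (hr _ h2)
  · have lt_iff : ∀ v, ρ v + M * c v < t ↔ c v < t / M ∨ (c v = t / M ∧ ρ v < t % M) := by
      intro v
      have ht := Nat.div_add_mod t M
      have := Nat.mod_lt t (show M > 0 by omega)
      have := hρ' v
      constructor
      · intro hv
        rcases lt_trichotomy (c v) (t / M) with h | h | h
        · exact .inl h
        · exact .inr ⟨h, by rw [h] at hv; omega⟩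
        · have := Nat.mul_le_mul_left M h
          rw [Nat.mul_succ] at this
          omega
      · rintro (h | ⟨h, h'⟩)
        · have := Nat.mul_le_mul_left M h
          rw [Nat.mul_succ] at this
          omega
        · rw [h]; omega
    by_cases hC : ∃ u, c u = t / M
    · obtain ⟨u, hu⟩ := hC
      obtain ⟨f, g, hfg⟩ := hw (G.connectedComponentMk u) (t % M)
      let C := G.connectedComponentMk u
      refine ⟨fun i x => if hx : x ∈ C then f i ⟨x, hx⟩ else 0,
        fun i x => if hx : x ∈ C then g i ⟨x, hx⟩ else 0, fun x hx y hy => ?_⟩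
      have hx := (lt_iff x).1 hx
      have hy := mt (lt_iff y).2 hy
      have hCc : ∀ v, v ∈ C ↔ c v = t / M := fun v => by
        rw [← hu]
        exact ⟨fun h => congrArg (fun D => (e D : ℕ)) h, fun h => hc h⟩
      by_cases hxC : x ∈ C
      · by_cases hyC : y ∈ C
        · have hx' := (hCc x).1 hxC
          have hy' := (hCc y).1 hyC
          have := hfg ⟨x, hxC⟩ (by
            have := hρ C x hxC
            simp only [Set.mem_ofPred_eq]
            rw [← this]
            omega) ⟨y, hyC⟩ (by
            have := hρ C y hyC
            simp only [Set.mem_ofPred_eq]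
            rw [← this]
            omega)
          simp only [hxC, hyC, dif_pos]
          exact this
        · have : ¬ G.Adj x y := fun h => hyC ((hadj h).symm.trans hxC)
          simp [hyC, this]
      · have : ¬ G.Adj x y := fun h => by
          have h1 : c x = c y := congrArg (fun D => (e D : ℕ)) (hadj h)
          rw [hCc] at hxC
          omega
        simp [hxC, this]
    -- No component has index `t / M`, so no component is split and no edge crosses the cut.
    · push Not at hC
      refine (CutLE.of_types (k := 0) (fun _ => none) (fun x hx _ y hy h => ?_)
        (fun _ _ _ _ _ h => absurd rfl h)).mono (Nat.zero_le k)
      have hx := (lt_iff x).1 hx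
      have hy := mt (lt_iff y).2 hy
      have h1 : c x = c y := congrArg (fun D => (e D : ℕ)) (hadj h)
      have := hC x
      omega

/-- An orientation of a multipartite graph without directed triangles and directed cycles of
length four admits a key function that increases along its arcs. -/
theorem exists_key_of_tournament {V ι : Type*} [Fintype V] (p : V → ι) (R : V → V → Prop)
    (hp : ∀ u v, R u v → p u ≠ p v) (hasymm : ∀ u v, R u v → ¬ R v u)
    (h3 : ∀ u v w, R u v → R v w → p u ≠ p w → R u w)
    (h4 : ∀ u c v w, R u c → R c v → R v w → p u = p v → p c = p w → R u w) :
    ∃ φ : V → ℕ, ∀ u v, R u v → φ u < φ v := by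
  classical
  -- Every directed path shortens to an arc or, when its ends lie in one part, to two arcs. Hence
  -- there are no directed cycles, and the number of ancestors is a key.
  have hS : ∀ u v, Relation.TransGen R u v → R u v ∨ (p u = p v ∧ ∃ c, R u c ∧ R c v) := by
    intro u v h
    induction h with
    | single h => exact .inl h
    | tail _ hvw ih =>
      rename_i v w _
      rcases ih with h | ⟨hpu, c, h1, h2⟩
      · by_cases hw : p u = p w
        · exact .inr ⟨hw, v, h, hvw⟩
        · exact .inl (h3 _ _ _ h hvw hw)
      · left
        have hw : p u ≠ p w := hpu ▸ hp _ _ hvw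
        by_cases hc : p c = p w
        · exact h4 _ _ _ _ h1 h2 hvw hpu hc
        · exact h3 _ _ _ h1 (h3 _ _ _ h2 hvw hc) hw
  have hirr : ∀ u, ¬ Relation.TransGen R u u := fun u h => by
    rcases hS u u h with h | ⟨-, c, h1, h2⟩
    · exact hp _ _ h rfl
    · exact hasymm _ _ h1 h2
  refine ⟨fun v => (Finset.univ.filter fun u => Relation.TransGen R u v).card, fun u v huv => ?_⟩
  refine Finset.card_lt_card (Finset.ssubset_iff_of_subset ?_ |>.2 ⟨u, ?_, ?_⟩)
  · intro w hw
    simp only [Finset.mem_filter, Finset.mem_univ, true_and] at hw ⊢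
    exact hw.tail huv
  · simpa using Relation.TransGen.single huv
  · simpa using hirr u

/-! ### Forbidden induced subgraphs as conditions on walks -/

/-- There is no triangle. -/
def TriFree {V : Type*} (G : SimpleGraph V) : Prop :=
  ∀ a b c, G.Adj a b → G.Adj b c → G.Adj c a → False

/-- There is no closed walk of length five. -/
def PentaFree {V : Type*} (G : SimpleGraph V) : Prop :=
  ∀ a b c d e, G.Adj a b → G.Adj b c → G.Adj c d → G.Adj d e → G.Adj e a → False

/-- In a triangle-free graph this says that `S_{1,2,2}` is not an induced subgraph: the centre
is `c`, the short leg `x`, and the long legs are `(y, z)` and `(y', z')`. -/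
def ClawFree {V : Type*} (G : SimpleGraph V) : Prop :=
  ∀ c x y z y' z', G.Adj c x → G.Adj c y → G.Adj c y' → G.Adj y z → G.Adj y' z' →
    ¬ G.Adj x z → ¬ G.Adj x z' → ¬ G.Adj y z' → ¬ G.Adj y' z → ¬ G.Adj z z' → False

theorem TriFree.of_inducedFree {V : Type*} {G : SimpleGraph V}
    (h : InducedFree (SimpleGraph.completeGraph (Fin 3)) G) : TriFree G := by
  intro a b c hab hbc hca
  have := hab.ne
  have := hbc.ne
  have := hca.ne
  refine h ⟨⟨⟨![a, b, c], ?_⟩, ?_⟩⟩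
  · intro i j hij
    fin_cases i <;> fin_cases j <;> simp_all
  · intro i j
    have := hab.symm
    have := hbc.symm
    have := hca.symm
    change G.Adj (![a, b, c] i) (![a, b, c] j) ↔ _
    fin_cases i <;> fin_cases j <;> simp_all

/-- A chord of a closed 5-walk would complete a triangle, and so would a coincidence of two of its
vertices make a chord or a loop; the walk is thus an induced cycle. -/
theorem PentaFree.of_inducedFree {V : Type*} {G : SimpleGraph V} (ht : TriFree G)
    (h : InducedFree (SimpleGraph.cycleGraph 5) G) : PentaFree G := by
  intro a b c d e hab hbc hcd hde hea
  have h1 : ¬ G.Adj a c := fun h => ht _ _ _ hab hbc h.symm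
  have h2 : ¬ G.Adj b d := fun h => ht _ _ _ hbc hcd h.symm
  have h3 : ¬ G.Adj c e := fun h => ht _ _ _ hcd hde h.symm
  have h4 : ¬ G.Adj d a := fun h => ht _ _ _ hde hea h.symm
  have h5 : ¬ G.Adj e b := fun h => ht _ _ _ hea hab h.symm
  have hne : a ≠ b ∧ a ≠ c ∧ a ≠ d ∧ a ≠ e ∧ b ≠ c ∧ b ≠ d ∧ b ≠ e ∧ c ≠ d ∧ c ≠ e ∧ d ≠ e := by
    refine ⟨hab.ne, ?_, ?_, hea.ne', hbc.ne, ?_, ?_, hcd.ne, ?_, hde.ne⟩ <;> rintro rfl <;>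
      simp_all [G.adj_comm]
  obtain ⟨n1, n2, n3, n4, n5, n6, n7, n8, n9, n10⟩ := hne
  refine h ⟨⟨⟨![a, b, c, d, e], ?_⟩, ?_⟩⟩
  · intro i j hij
    fin_cases i <;> fin_cases j <;> simp_all
  · intro i j
    change G.Adj (![a, b, c, d, e] i) (![a, b, c, d, e] j) ↔ _
    fin_cases i <;> fin_cases j <;> simp_all [G.adj_comm, SimpleGraph.cycleGraph_adj] <;> decide

theorem ClawFree.of_inducedFree {V : Type*} {G : SimpleGraph V} (ht : TriFree G)
    (h : InducedFree (subdividedClaw ![1, 2, 2]) G) : ClawFree G := by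
  intro c x y z y' z' hx hy hy' hz hz' n1 n2 n3 n4 n5
  have h1 : ¬ G.Adj x y := fun h => ht _ _ _ hx h hy.symm
  have h2 : ¬ G.Adj x y' := fun h => ht _ _ _ hx h hy'.symm
  have h3 : ¬ G.Adj y y' := fun h => ht _ _ _ hy h hy'.symm
  have h4 : ¬ G.Adj c z := fun h => ht _ _ _ hy hz h.symm
  have h5 : ¬ G.Adj c z' := fun h => ht _ _ _ hy' hz' h.symm
  let f : Option (Σ a : Fin 3, Fin (![1, 2, 2] a)) → V := fun u => match u with
    | none => c
    | some ⟨0, _⟩ => x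
    | some ⟨1, p⟩ => if (p : ℕ) = 0 then y else z
    | some ⟨2, p⟩ => if (p : ℕ) = 0 then y' else z'
  have hne : c ≠ z ∧ c ≠ z' ∧ x ≠ y ∧ x ≠ z ∧ x ≠ y' ∧ x ≠ z' ∧ y ≠ y' ∧ y ≠ z' ∧ z ≠ y' ∧
      z ≠ z' := by
    refine ⟨?_, ?_, ?_, ?_, ?_, ?_, ?_, ?_, ?_, ?_⟩ <;> rintro rfl <;> simp_all [G.adj_comm]
  have := hx.ne
  have := hy.ne
  have := hy'.ne
  have := hz.ne
  have := hz'.ne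
  obtain ⟨m1, m2, m3, m4, m5, m6, m7, m8, m9, m10⟩ := hne
  have cases : ∀ u : Option (Σ a : Fin 3, Fin (![1, 2, 2] a)),
      u = none ∨ u = some ⟨0, (0 : Fin 1)⟩ ∨ u = some ⟨1, (0 : Fin 2)⟩ ∨
      u = some ⟨1, (1 : Fin 2)⟩ ∨ u = some ⟨2, (0 : Fin 2)⟩ ∨ u = some ⟨2, (1 : Fin 2)⟩ := by
    decide
  refine h ⟨⟨⟨f, ?_⟩, ?_⟩⟩
  · intro u v huv
    rcases cases u with rfl | rfl | rfl | rfl | rfl | rfl <;>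
    rcases cases v with rfl | rfl | rfl | rfl | rfl | rfl <;> simp_all [f]
  · intro u v
    rcases cases u with rfl | rfl | rfl | rfl | rfl | rfl <;>
    rcases cases v with rfl | rfl | rfl | rfl | rfl | rfl <;>
      simp_all [f, G.adj_comm, subdividedClaw] <;> first | decide | exact fun h => n4 h.symm

section Induce

variable {V W : Type*} {G : SimpleGraph V} {H : SimpleGraph W}

theorem TriFree.comap (f : H ↪g G) (h : TriFree G) : TriFree H := fun a b c => by
  have := h (f a) (f b) (f c)
  simpa only [f.map_adj_iff] using this

theorem PentaFree.comap (f : H ↪g G) (h : PentaFree G) : PentaFree H := fun a b c d e => by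
  have := h (f a) (f b) (f c) (f d) (f e)
  simpa only [f.map_adj_iff] using this

theorem ClawFree.comap (f : H ↪g G) (h : ClawFree G) : ClawFree H := fun c x y z y' z' => by
  have := h (f c) (f x) (f y) (f z) (f y') (f z')
  simpa only [f.map_adj_iff] using this

end Induce

/-! ### Blow-ups and long induced cycles -/

/-- Blow-ups of paths and cycles have linear rank-width at most `3`. -/
theorem HasWidth.of_blowup {V : Type*} [Fintype V] {G : SimpleGraph V} (φ : V → ℕ)
    (htwin : ∀ x x' y, φ x = φ x' → G.Adj x y → G.Adj x' y)
    (hadj : ∀ x y, G.Adj x y → φ x < φ y → φ y = φ x + 1 ∨ φ x = 0)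
    (hind : ∀ x y, G.Adj x y → φ x ≠ φ y) : HasWidth G 3 := by
  refine HasWidth.of_key φ fun X t h1 h2 => ?_
  -- Edges leaving `X` start at level `t`, at level `t - 1`, or, because a cycle wraps around, at
  -- level `0`. Each of these levels consists of twins.
  refine CutLE.of_types (fun x => if φ x = 0 then some 0 else if φ x = t then some 1 else
    if φ x + 1 = t then some 2 else none) (fun x hx hτ y hy hxy => ?_)
    fun x hx x' hx' hτ hn y hy hxy => htwin x x' y ?_ hxy
  · have := h2 x hx
    have := mt (h1 y) hy
    have := hind x y hxy
    have := hadj x y hxy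
    split_ifs at hτ
    omega
  · split_ifs at hτ hn <;> simp_all <;> omega

/-- The map `c` is an induced cycle, indexed by a cyclic ring whose generator is `d`. -/
def IsIndCycle {V R : Type*} [CommRing R] (G : SimpleGraph V) (d : R) (c : R → V) : Prop :=
  ∀ i j, G.Adj (c i) (c j) ↔ j = i + d ∨ i = j + d

section Cycle

variable {V R : Type*} [CommRing R] {G : SimpleGraph V} {n : ℕ} {d : R}

theorem natCast_zmod_ne_zero {k : ℕ} (h0 : 0 < k) (hk : k < n) : (k : ZMod n) ≠ 0 := by
  rw [Ne, ZMod.natCast_eq_zero_iff]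
  exact fun h => absurd (Nat.le_of_dvd h0 h) (by omega)

theorem small_zmod_ne_zero (hn : 7 ≤ n) : ∀ k : ℕ, 0 < k → k < 7 → (k : ZMod n) * 1 ≠ 0 := by
  intro k h h'
  rw [mul_one]
  exact natCast_zmod_ne_zero h (by omega)

/-- A vertex with a neighbour on a long induced cycle has the same neighbours on the cycle as
some vertex of the cycle. -/
theorem IsIndCycle.exists_type (hS : ClawFree G) (h5 : PentaFree G)
    (hd : ∀ k : ℕ, 0 < k → k < 7 → (k : R) * d ≠ 0)
    {c : R → V} (hc : IsIndCycle G d c) {w : V} {i₀ : R} (hw : G.Adj w (c i₀)) :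
    ∃ j, ∀ i, G.Adj w (c i) ↔ j = i + d ∨ i = j + d := by
  have n1 : d ≠ 0 := by simpa using hd 1 (by omega) (by omega)
  have n2 : 2 * d ≠ 0 := hd 2 (by omega) (by omega)
  have n3 : 3 * d ≠ 0 := hd 3 (by omega) (by omega)
  have n4 : 4 * d ≠ 0 := hd 4 (by omega) (by omega)
  have n5 : 5 * d ≠ 0 := hd 5 (by omega) (by omega)
  have n6 : 6 * d ≠ 0 := hd 6 (by omega) (by omega)
  -- The claw centred at `c i` with short leg `w` gives a second neighbour at distance two. The claw
  -- centred at `w` then confines any third neighbour to distance two from these (`hB`), where it is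
  -- excluded too (`hC`).
  have hA : ∀ i, G.Adj w (c i) → G.Adj w (c (i + 2 * d)) ∨ G.Adj w (c (i - 2 * d)) := by
    intro i hi
    by_contra! hcon
    refine hS (c i) w (c (i + d)) (c (i + 2 * d)) (c (i - d)) (c (i - 2 * d)) hi.symm ?_ ?_ ?_ ?_
      hcon.1 hcon.2 ?_ ?_ ?_ <;> rw [hc] <;> clear hcon hi <;> grind
  have hB : ∀ i j, G.Adj w (c i) → G.Adj w (c (i + 2 * d)) → G.Adj w (c j) →
      j = i ∨ j = i + 2 * d ∨ j = i - 2 * d ∨ j = i + 4 * d := by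
    intro i j hi hi2 hj
    by_contra! hcon
    refine hS w (c j) (c i) (c (i - d)) (c (i + 2 * d)) (c (i + 3 * d)) hj hi hi2 ?_ ?_ ?_ ?_ ?_
      ?_ ?_ <;> rw [hc] <;> clear hi hi2 hj hA <;> grind
  have hC : ∀ i, G.Adj w (c i) → G.Adj w (c (i + 2 * d)) → ¬ G.Adj w (c (i + 4 * d)) := by
    intro i hi hi2 hi4
    clear hA hB
    -- On a cycle of length seven the ends of the two long legs below would be adjacent; there the
    -- absence of closed 5-walks is used instead.
    by_cases n7 : 7 * d = 0
    · refine h5 w (c (i + 4 * d)) (c (i + 5 * d)) (c (i + 6 * d)) (c i) hi4 ?_ ?_ ?_ hi.symm <;>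
        rw [hc] <;> clear hi hi2 hi4 <;> grind
    · refine hS w (c (i + 2 * d)) (c i) (c (i - d)) (c (i + 4 * d)) (c (i + 5 * d)) hi2 hi hi4
        ?_ ?_ ?_ ?_ ?_ ?_ ?_ <;> rw [hc] <;> clear hi hi2 hi4 <;> grind
  have hD : ∀ i, G.Adj w (c i) → G.Adj w (c (i + 2 * d)) →
      ∃ j, ∀ i, G.Adj w (c i) ↔ j = i + d ∨ i = j + d := by
    intro i hi hi2
    refine ⟨i + d, fun k => ⟨fun hk => ?_, fun hk => ?_⟩⟩
    · rcases hB i k hi hi2 hk with rfl | rfl | rfl | rfl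
      · left; rfl
      · right; ring
      · exact absurd hi2 (by
          have := hC (i - 2 * d) hk (by rwa [sub_add_cancel])
          rwa [show i - 2 * d + 4 * d = i + 2 * d by ring] at this)
      · exact absurd hk (hC i hi hi2)
    · rcases hk with hk | rfl
      · rwa [← add_right_cancel hk]
      · rwa [add_assoc, ← two_mul]
  rcases hA i₀ hw with h | h
  · exact hD i₀ hw h
  · exact hD (i₀ - 2 * d) h (by rwa [sub_add_cancel])

theorem IsIndCycle.update [DecidableEq R] {c : R → V} (hc : IsIndCycle G d c) {a : R}
    {x : V} (hx : ∀ i, G.Adj x (c i) ↔ a = i + d ∨ i = a + d) :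
    IsIndCycle G d (Function.update c a x) := by
  intro i j
  by_cases hi : i = a <;> by_cases hj : j = a
  · have := hc a a
    simpa [hi, hj] using this
  · subst hi
    simp only [update_self, update_of_ne hj, hx]
    tauto
  · subst hj
    simp only [update_self, update_of_ne hi, G.adj_comm, hx]
  · simp only [update_of_ne hi, update_of_ne hj, hc i j]

/-- Since `w` imitates `c j`, the vertex `c (j + d)` is the centre of a claw with short leg `c j`
and long legs along the cycle and along `w, u`. By connectivity, the cycle therefore dominates the
graph. -/
theorem IsIndCycle.not_adj_of_not_dominated (hS : ClawFree G)
    (hd : ∀ k : ℕ, 0 < k → k < 7 → (k : R) * d ≠ 0)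
    {c : R → V} (hc : IsIndCycle G d c) {w u : V} {j : R}
    (hw : ∀ i, G.Adj w (c i) ↔ j = i + d ∨ i = j + d) (hu : ∀ i, ¬ G.Adj u (c i)) :
    ¬ G.Adj w u := by
  intro hwu
  have n1 : d ≠ 0 := by simpa using hd 1 (by omega) (by omega)
  have n2 : 2 * d ≠ 0 := hd 2 (by omega) (by omega)
  have n3 : 3 * d ≠ 0 := hd 3 (by omega) (by omega)
  have n4 : 4 * d ≠ 0 := hd 4 (by omega) (by omega)
  refine hS (c (j + d)) (c j) (c (j + 2 * d)) (c (j + 3 * d)) w u ?_ ?_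
    ((hw _).2 (.inr rfl)).symm ?_ hwu ?_ (fun h => hu _ h.symm) (fun h => hu _ h.symm) ?_
    fun h => hu _ h.symm
  all_goals first | rw [hc] | rw [hw]
  all_goals grind

/-- In the setting of the next theorem, adjacency of two vertices is determined by their types. -/
theorem IsIndCycle.adj_iff (hS : ClawFree G) (h5 : PentaFree G)
    (hd : ∀ k : ℕ, 0 < k → k < 7 → (k : R) * d ≠ 0) {c : R → V} (hc : IsIndCycle G d c)
    {x y : V} {a b : R} (hx : ∀ i, G.Adj x (c i) ↔ a = i + d ∨ i = a + d)
    (hy : ∀ i, G.Adj y (c i) ↔ b = i + d ∨ i = b + d) :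
    G.Adj x y ↔ b = a + d ∨ a = b + d := by
  classical
  have n1 : d ≠ 0 := by simpa using hd 1 (by omega) (by omega)
  have n2 : 2 * d ≠ 0 := hd 2 (by omega) (by omega)
  have n4 : 4 * d ≠ 0 := hd 4 (by omega) (by omega)
  -- With `x` in place of `c a` the cycle stays induced, so `y` has a type `k` on it as well. This
  -- type agrees with `b` away from `a`, and whether `y` sees `x` is read off from `k`.
  have hc' := hc.update hx
  have hoff : ∀ i, i ≠ a → Function.update c a x i = c i := fun i hi => update_of_ne hi ..
  obtain ⟨k, hk⟩ : ∃ k, ∀ i, G.Adj y (Function.update c a x i) ↔ k = i + d ∨ i = k + d := by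
    by_cases h : b + d = a
    · refine hc'.exists_type hS h5 hd (i₀ := b - d) ?_
      rw [hoff _ (by clear hx hy hoff; grind), hy]
      left; ring
    · refine hc'.exists_type hS h5 hd (i₀ := b + d) ?_
      rw [hoff _ h, hy]
      right; rfl
  have hk' : ∀ i, i ≠ a → ((k = i + d ∨ i = k + d) ↔ (b = i + d ∨ i = b + d)) := by
    intro i hi
    rw [← hk, hoff i hi, hy]
  have hkx := hk a
  rw [update_self] at hkx
  rw [G.adj_comm, hkx]
  have e1 := hk' (k + d)
  have e2 := hk' (k - d)
  have e3 := hk' (b + d)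
  have e4 := hk' (b - d)
  clear hk hk' hkx hc' hoff hx hy hc hd h5 hS
  grind +splitImp

/-- A connected `(K_3, C_5, S_{1,2,2})`-free graph with a long induced cycle is a blow-up of the
cycle. -/
theorem IsIndCycle.hasWidth [Fintype V] (hG : G.Preconnected) (hS : ClawFree G)
    (h5 : PentaFree G) (hn : 7 ≤ n) {c : ZMod n → V} (hc : IsIndCycle G 1 c) : HasWidth G 3 := by
  have : NeZero n := ⟨by omega⟩
  have hd := small_zmod_ne_zero hn
  have hdom : ∀ v, ∃ j, ∀ i, G.Adj v (c i) ↔ j = i + 1 ∨ i = j + 1 := by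
    intro v
    have hr := (SimpleGraph.reachable_iff_reflTransGen (c 0) v).1 (hG _ v)
    induction hr with
    | refl =>
      exact hc.exists_type hS h5 hd (i₀ := 1) ((hc 0 1).2 (.inl (zero_add 1).symm))
    | tail _ h ih =>
      obtain ⟨j, hj⟩ := ih
      by_contra hcon
      refine hc.not_adj_of_not_dominated hS hd hj (fun i hi => hcon ?_) h
      exact hc.exists_type hS h5 hd hi
  choose φ hφ using hdom
  have hadj : ∀ x y, G.Adj x y ↔ φ y = φ x + 1 ∨ φ x = φ y + 1 := fun x y =>
    hc.adj_iff hS h5 hd (hφ x) (hφ y)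
  refine HasWidth.of_blowup (fun v => (φ v).val) (fun x x' y h hxy => ?_) (fun x y hxy hlt => ?_)
    fun x y hxy h => ?_
  · have := ZMod.val_injective n h
    rw [hadj] at hxy ⊢
    rwa [← this]
  · have hv : ∀ a : ZMod n, (a + 1).val = a.val + 1 ∨ (a + 1).val = 0 := by
      intro a
      by_cases h : a.val + 1 < n
      · left
        have : (1 : ZMod n).val = 1 := by
          rw [← Nat.cast_one, ZMod.val_natCast_of_lt (by omega)]
        rw [ZMod.val_add_of_lt] <;> omega
      · right
        have : a.val + 1 = n := by have := ZMod.val_lt a; omega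
        have : ((a.val + 1 : ℕ) : ZMod n) = 0 := by rw [this]; simp
        push_cast at this
        rw [ZMod.natCast_zmod_val] at this
        rw [this]; simp
    rcases (hadj x y).1 hxy with h | h
    · rcases hv (φ x) with h' | h' <;> rw [← h] at h' <;> omega
    · rcases hv (φ y) with h' | h' <;> rw [← h] at h' <;> omega
  · have := ZMod.val_injective n h
    have h1 := hd 1 (by omega) (by omega)
    rw [hadj, this] at hxy
    simp_all

end Cycle

theorem zmod_eq_add_one_iff {n : ℕ} [NeZero n] (hn : 2 ≤ n) (i j : ZMod n) :
    j = i + 1 ↔ j.val = i.val + 1 ∨ (i.val + 1 = n ∧ j.val = 0) := by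
  have h1 : (1 : ZMod n).val = 1 := by
    rw [← Nat.cast_one, ZMod.val_natCast_of_lt (by omega)]
  have hi := ZMod.val_lt i
  have hj := ZMod.val_lt j
  rw [← (ZMod.val_injective n).eq_iff, ZMod.val_add, h1]
  rcases Nat.lt_or_ge (i.val + 1) n with h | h
  · rw [Nat.mod_eq_of_lt h]
    omega
  · have h : i.val + 1 = n := by omega
    rw [h, Nat.mod_self]
    omega

theorem isIndCycle_of_nat {V : Type*} {G : SimpleGraph V} {n : ℕ} [NeZero n] (hn : 2 ≤ n)
    {f : ℕ → V} (hf : ∀ i j, i < j → j < n → (G.Adj (f i) (f j) ↔ j = i + 1 ∨ (i = 0 ∧ j + 1 = n))) :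
    IsIndCycle G (1 : ZMod n) fun i => f i.val := by
  intro i j
  have hi := ZMod.val_lt i
  have hj := ZMod.val_lt j
  simp only [zmod_eq_add_one_iff hn]
  rcases lt_trichotomy i.val j.val with h | h | h
  · rw [hf _ _ h hj]
    omega
  · rw [h]
    simp only [SimpleGraph.irrefl, false_iff]
    omega
  · rw [G.adj_comm, hf _ _ h hi]
    omega

/-! ### Shortest odd closed walks -/

/-- A non-bipartite graph without closed walks of length `3` or `5` contains a long induced odd
cycle. -/
theorem exists_isIndCycle_of_not_isBipartite {V : Type*} {G : SimpleGraph V} (ht : TriFree G)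
    (h5 : PentaFree G) (hb : ¬ G.IsBipartite) :
    ∃ (n : ℕ) (c : ZMod n → V), 7 ≤ n ∧ IsIndCycle G 1 c := by
  classical
  let P : ℕ → Prop := fun n => Odd n ∧ ∃ f : ℕ → V, f n = f 0 ∧ ∀ i < n, G.Adj (f i) (f (i + 1))
  have hP : ∃ n, P n := by
    have := mt SimpleGraph.two_colorable_iff_forall_loop_even.2 hb
    push Not at this
    obtain ⟨u, w, hw⟩ := this
    refine ⟨w.length, by simpa using hw, w.getVert, by simp, fun i hi => w.adj_getVert_succ hi⟩
  obtain ⟨hodd, f, hf0, hf⟩ := Nat.find_spec hP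
  have hmin : ∀ m, m < Nat.find hP → ¬ P m := fun m => Nat.find_min hP
  generalize Nat.find hP = n at *
  obtain ⟨k, rfl⟩ := hodd
  -- A chord splits the closed walk into two of opposite parity, and the odd one is shorter.
  have hchord : ∀ i j, i < j → j < 2 * k + 1 → G.Adj (f i) (f j) →
      j = i + 1 ∨ (i = 0 ∧ j + 1 = 2 * k + 1) := by
    intro i j hij hj hadj
    by_contra hcon
    rcases Nat.even_or_odd' (j - i) with ⟨m, hm | hm⟩
    · refine hmin (j - i + 1) (by omega) ⟨⟨m, by omega⟩,
        fun t => if t ≤ j - i then f (i + t) else f i, by simp, fun t ht => ?_⟩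
      rcases Nat.lt_or_ge t (j - i) with h | h
      · simp only [show t ≤ j - i by omega, show t + 1 ≤ j - i by omega, if_true]
        exact hf (i + t) (by omega)
      · obtain rfl : t = j - i := by omega
        simp only [le_refl, if_true, show ¬ j - i + 1 ≤ j - i by omega, if_false]
        rw [show i + (j - i) = j by omega]
        exact hadj.symm
    · refine hmin (2 * k + 1 - (j - i) + 1) (by omega) ⟨⟨k - m, by omega⟩,
        fun t => if t ≤ i then f t else f (t + j - i - 1), ?_, fun t ht => ?_⟩
      · simp only [show ¬ 2 * k + 1 - (j - i) + 1 ≤ i by omega, if_false, Nat.zero_le, if_true]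
        rw [← hf0]
        congr 1
        omega
      · rcases lt_trichotomy t i with h | h | h
        · simp only [show t ≤ i by omega, show t + 1 ≤ i by omega, if_true]
          exact hf t (by omega)
        · subst h
          simp only [le_refl, if_true, show ¬ t + 1 ≤ t by omega, if_false]
          rwa [show t + 1 + j - t - 1 = j by omega]
        · simp only [show ¬ t ≤ i by omega, show ¬ t + 1 ≤ i by omega, if_false]
          have := hf (t + j - i - 1) (by omega)
          rwa [show t + j - i - 1 + 1 = t + 1 + j - i - 1 by omega] at this
  have hk : 3 ≤ k := by
    by_contra hk
    obtain rfl | rfl | rfl : k = 0 ∨ k = 1 ∨ k = 2 := by omega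
    · exact (hf 0 (by omega)).ne hf0.symm
    · refine ht (f 0) (f 1) (f 2) (hf 0 (by omega)) (hf 1 (by omega)) ?_
      rw [← hf0]
      exact hf 2 (by omega)
    · refine h5 (f 0) (f 1) (f 2) (f 3) (f 4) (hf 0 (by omega)) (hf 1 (by omega))
        (hf 2 (by omega)) (hf 3 (by omega)) ?_
      rw [← hf0]
      exact hf 4 (by omega)
  refine ⟨2 * k + 1, fun i => f i.val, by omega, isIndCycle_of_nat (by omega) fun i j hij hj => ?_⟩
  refine ⟨hchord i j hij hj, ?_⟩
  rintro (rfl | ⟨rfl, hj'⟩)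
  · exact hf i (by omega)
  · rw [← hf0, ← hj']
    exact (hf j (by omega)).symm

/-! ### Bipartite graphs whose bipartite complement consists of chain graphs -/

/-- The bipartite complement with respect to a two-colouring. -/
def bipComplement {V : Type*} (G : SimpleGraph V) (c : V → Bool) : SimpleGraph V where
  Adj u v := c u ≠ c v ∧ ¬ G.Adj u v
  symm := ⟨fun _ _ h => ⟨h.1.symm, fun h' => h.2 h'.symm⟩⟩
  loopless := ⟨fun _ h => h.1 rfl⟩

/-- There are two independent edges and a vertex, in the colour class of one end of each of
the edges, that is not adjacent to their other ends. -/
def HasTwoEdgesAndVertex {V : Type*} (G : SimpleGraph V) (c : V → Bool) : Prop :=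
  ∃ x₁ x₂ y₁ y₂ y₃, G.Adj x₁ y₁ ∧ G.Adj x₂ y₂ ∧ c x₁ = c x₂ ∧ c x₁ ≠ c y₃ ∧
    ¬ G.Adj x₁ y₂ ∧ ¬ G.Adj x₂ y₁ ∧ ¬ G.Adj x₁ y₃ ∧ ¬ G.Adj x₂ y₃

section

variable {V : Type*} {G : SimpleGraph V} {c : V → Bool}

theorem CutLE.of_three {X : Set V} (f₀ f₁ f₂ g₀ g₁ g₂ : V → ZMod 2)
    (h : ∀ x ∈ X, ∀ y ∉ X, (G.Adj x y → f₀ x * g₀ y + f₁ x * g₁ y + f₂ x * g₂ y = 1) ∧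
      (¬ G.Adj x y → f₀ x * g₀ y + f₁ x * g₁ y + f₂ x * g₂ y = 0)) : CutLE G X 3 :=
  ⟨![f₀, f₁, f₂], ![g₀, g₁, g₂], fun x hx y hy => by
    simpa [Fin.sum_univ_three] using h x hx y hy⟩

/-- If both chords were missing, the walk `y₂, x₁, y₃, x₂, y₁` would be an induced path of the
complement, which is exactly the excluded configuration in `G`. -/
theorem bipComplement_chord (hgap : ¬ HasTwoEdgesAndVertex G c) {x₁ x₂ y₁ y₂ y₃ : V}
    (h1 : (bipComplement G c).Adj y₂ x₁) (h2 : (bipComplement G c).Adj x₁ y₃)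
    (h3 : (bipComplement G c).Adj y₃ x₂) (h4 : (bipComplement G c).Adj x₂ y₁) :
    (bipComplement G c).Adj x₁ y₁ ∨ (bipComplement G c).Adj x₂ y₂ := by
  by_contra! hcon
  obtain ⟨c1, a1⟩ := h1
  obtain ⟨c2, a2⟩ := h2
  obtain ⟨c3, a3⟩ := h3
  obtain ⟨c4, a4⟩ := h4
  refine hgap ⟨x₁, x₂, y₁, y₂, y₃, ?_, ?_, ?_, c2, fun h => a1 h.symm, a4, a2, fun h => a3 h.symm⟩
  · by_contra h
    refine hcon.1 ⟨?_, h⟩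
    cases hx : c x₁ <;> cases hy : c y₁ <;> simp_all
  · by_contra h
    refine hcon.2 ⟨?_, h⟩
    cases hx : c x₂ <;> cases hy : c y₂ <;> simp_all
  · cases hx : c x₁ <;> cases hy : c x₂ <;> simp_all

/-- Walks of length four are shortened by a chord, so distances in a component are at most two
within a colour class and at most three between the classes. -/
theorem bipComplement_reachable (hgap : ¬ HasTwoEdgesAndVertex G c) {u v : V} (h : (bipComplement G c).Reachable u v) :
    (c u = c v → u = v ∨ ∃ b, (bipComplement G c).Adj u b ∧ (bipComplement G c).Adj b v) ∧
    (c u ≠ c v → ∃ b, (bipComplement G c).Adj b v ∧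
      (u = b ∨ ∃ d, (bipComplement G c).Adj u d ∧ (bipComplement G c).Adj d b)) := by
  rw [SimpleGraph.reachable_iff_reflTransGen] at h
  induction h with
  | refl => simp
  | @tail v w _ hvw ih =>
    have hcvw : c v ≠ c w := hvw.1
    by_cases huv : c u = c v
    · refine ⟨fun h => absurd (huv.symm.trans h) hcvw, fun _ => ⟨v, hvw, ih.1 huv⟩⟩
    · obtain ⟨b, hb, rfl | ⟨d, hd1, hd2⟩⟩ := ih.2 huv
      · exact ⟨fun _ => .inr ⟨v, hb, hvw⟩, fun h => absurd (by
          cases hx : c u <;> cases hy : c v <;> cases hz : c w <;> simp_all) h⟩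
      · refine ⟨fun _ => .inr ?_, fun h => absurd (by
          cases hx : c u <;> cases hy : c v <;> cases hz : c w <;> simp_all) h⟩
        rcases bipComplement_chord hgap hd1 hd2 hb hvw with h | h
        · exact ⟨d, hd1, h⟩
        · exact ⟨v, h.symm, hvw⟩

/-- A common neighbour of `u` and `v` completes the walk of length four that must have a chord. Thus
no component contains two independent edges. -/
theorem bipComplement_chain (hgap : ¬ HasTwoEdgesAndVertex G c) {u v y z : V}
    (h : (bipComplement G c).Reachable u v) (huv : c u = c v)
    (hy : (bipComplement G c).Adj u y) (hz : (bipComplement G c).Adj v z) :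
    (bipComplement G c).Adj u z ∨ (bipComplement G c).Adj v y := by
  rcases (bipComplement_reachable hgap h).1 huv with rfl | ⟨b, h1, h2⟩
  · exact .inl hz
  · exact bipComplement_chord hgap hy.symm h1 h2 hz

/-- The components of the bipartite complement are chain graphs here, which gives the ordering. -/
theorem HasWidth.of_not_hasTwoEdgesAndVertex [Fintype V] (hc : ∀ u v, G.Adj u v → c u ≠ c v)
    (hgap : ¬ HasTwoEdgesAndVertex G c) : HasWidth G 3 := by
  classical
  set H := bipComplement G c with hH
  let D : V → ℕ := fun v => Fintype.equivFin H.ConnectedComponent (H.connectedComponentMk v)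
  have hD : ∀ u v, D u = D v ↔ H.Reachable u v := fun u v => by
    rw [← SimpleGraph.ConnectedComponent.eq, ← (Fintype.equivFin H.ConnectedComponent).apply_eq_iff_eq,
      Fin.ext_iff]
  -- Within a component of `H`, edges of `H` point from `false` to `true` and non-edges from `true`
  -- to `false`. There are only two parts, hence no triangles, and the chain property excludes
  -- directed 4-cycles.
  let R : V → V → Prop := fun u v => D u = D v ∧
    (c u = false ∧ c v = true ∧ H.Adj u v ∨ c u = true ∧ c v = false ∧ ¬ H.Adj u v)
  obtain ⟨ψ, hψ⟩ := exists_key_of_tournament c R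
    (by rintro u v ⟨-, ⟨h1, h2, -⟩ | ⟨h1, h2, -⟩⟩ <;> simp [h1, h2])
    (by
      rintro u v ⟨-, ⟨h1, h2, h3⟩ | ⟨h1, h2, h3⟩⟩ ⟨-, ⟨h1', h2', h3'⟩ | ⟨h1', h2', h3'⟩⟩ <;>
        first | exact absurd h3.symm h3' | exact absurd h3'.symm h3 | simp_all)
    (by
      rintro u v w ⟨-, ⟨h1, h2, h3⟩ | ⟨h1, h2, h3⟩⟩ ⟨-, ⟨h1', h2', h3'⟩ | ⟨h1', h2', h3'⟩⟩ h <;>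
        simp_all)
    (by
      rintro u k v w ⟨d1, ⟨h1, h2, h3⟩ | ⟨h1, h2, h3⟩⟩ ⟨d2, h4⟩ ⟨d3, h5⟩ huv hkw
      · refine ⟨d1.trans (d2.trans d3), .inl ⟨h1, hkw ▸ h2, ?_⟩⟩
        have h4 : ¬ H.Adj k v := by simp_all
        have h5 : H.Adj v w := by simp_all
        exact (bipComplement_chain hgap ((hD u v).1 (d1.trans d2)) huv h3 h5).resolve_right
          fun h => h4 h.symm
      · refine ⟨d1.trans (d2.trans d3), .inr ⟨h1, hkw ▸ h2, fun hcon => ?_⟩⟩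
        have h4 : H.Adj k v := by simp_all
        have h5 : ¬ H.Adj v w := by simp_all
        rcases bipComplement_chain hgap ((hD u v).1 (d1.trans d2)) huv hcon h4.symm with h | h
        · exact h3 h
        · exact h5 h)
  have hRtot : ∀ u v, D u = D v → c u ≠ c v → R u v ∨ R v u := by
    intro u v hd huv
    simp only [R, hd, true_and, H.adj_comm v u]
    cases hu : c u <;> cases hv : c v <;> by_cases H.Adj u v <;> simp_all
  set M := Finset.univ.sup ψ + 1 with hM
  have hψM : ∀ v, ψ v < M := fun v =>
    Nat.lt_succ_of_le (Finset.le_sup (f := ψ) (Finset.mem_univ v))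
  have hdiv : ∀ v, (ψ v + M * D v) / M = D v := fun v => by
    rw [Nat.add_mul_div_left _ _ (by omega), Nat.div_eq_of_lt (hψM v), zero_add]
  refine HasWidth.of_key (fun v => ψ v + M * D v) fun X t hX1 hX2 => ?_
  -- Between the colour classes `G` is complete except for the edges of `H`. The first two products
  -- give the complete bipartite pattern; the third cancels, modulo 2, the `false`-to-`true` pairs
  -- of the split component, all of which are edges of `H` by the ordering. Its `true`-to-`false`
  -- pairs are all non-edges of `H`.
  refine CutLE.of_three (fun x => if c x then 0 else 1) (fun x => if c x then 1 else 0)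
    (fun x => if c x = false ∧ D x = t / M then 1 else 0)
    (fun y => if c y then 1 else 0) (fun y => if c y then 0 else 1)
    (fun y => if c y = true ∧ D y = t / M then 1 else 0) fun x hx y hy => ?_
  have hx' := hX2 x hx
  have hy' := not_lt.1 (mt (hX1 y) hy)
  have hDx := Nat.div_le_div_right (c := M) hx'
  have hDy := Nat.div_le_div_right (c := M) hy'
  rw [hdiv] at hDx hDy
  have hR : ¬ R y x := fun h => by
    have h1 := hψ y x h
    rw [h.1] at hy'
    omega
  have hRxy : D x = D y → c x ≠ c y → R x y := fun hd h => (hRtot x y hd h).resolve_right hR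
  have hsame : H.Adj x y → D x = t / M ∧ D y = t / M := fun h => by
    have := (hD x y).2 h.reachable
    omega
  clear_value D
  cases hcx : c x <;> cases hcy : c y
  · have : ¬ G.Adj x y := fun h => hc _ _ h (hcx.trans hcy.symm)
    simp [this]
  · by_cases hq : D x = t / M ∧ D y = t / M
    · have hadj : H.Adj x y := by
        have := hRxy (by omega) (by simp [hcx, hcy])
        simp only [R, hcx, hcy] at this
        simpa using this.2
      have : ¬ G.Adj x y := hadj.2
      simp only [this, hq, and_self, if_true, if_false, Bool.false_eq_true, not_false_eq_true]
      decide
    · have : G.Adj x y := by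
        by_contra hcon
        exact hq (hsame ⟨by simp [hcx, hcy], hcon⟩)
      by_cases h : D x = t / M <;> by_cases h' : D y = t / M <;> simp_all
  · have : G.Adj x y := by
      by_contra hcon
      have hadj : H.Adj x y := ⟨by simp [hcx, hcy], hcon⟩
      have := hsame hadj
      have := hRxy (by omega) hadj.1
      simp_all [R]
    simp [this]
  · have : ¬ G.Adj x y := fun h => hc _ _ h (hcx.trans hcy.symm)
    simp [this]

end

/-! ### Long induced paths in bipartite graphs -/

/-- The first `k` values of `p` form an induced path. -/
def IsIndPath {V : Type*} (G : SimpleGraph V) (k : ℕ) (p : ℕ → V) : Prop :=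
  ∀ i j, i < k → j < k → (G.Adj (p i) (p j) ↔ j = i + 1 ∨ i = j + 1)

section

variable {V : Type*} {G : SimpleGraph V} {k : ℕ} {p : ℕ → V} {c : V → Bool}

theorem IsIndPath.mono (hp : IsIndPath G k p) {m : ℕ} (h : m ≤ k) : IsIndPath G m p :=
  fun i j hi hj => hp i j (by omega) (by omega)

theorem IsIndPath.reverse (hp : IsIndPath G k p) : IsIndPath G k fun i => p (k - 1 - i) := by
  intro i j hi hj
  rw [hp _ _ (by omega) (by omega)]
  omega

theorem IsIndPath.cons (hp : IsIndPath G k p) {w : V} (hw : ∀ i < k, G.Adj w (p i) ↔ i = 0) :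
    IsIndPath G (k + 1) fun i => if i = 0 then w else p (i - 1) := by
  intro i j hi hj
  rcases Nat.eq_zero_or_pos i with rfl | hi' <;> rcases Nat.eq_zero_or_pos j with rfl | hj'
  · simp
  · simp only [if_true, hj'.ne', if_false]
    rw [hw _ (by omega)]
    omega
  · simp only [if_true, hi'.ne', if_false]
    rw [G.adj_comm, hw _ (by omega)]
    omega
  · simp only [hi'.ne', hj'.ne', if_false]
    rw [hp _ _ (by omega) (by omega)]
    omega

/-- Injectivity is not part of the definition and follows only from `k ≥ 4`: for `k = 3` the two
ends may coincide. -/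
theorem IsIndPath.length_le [Fintype V] (hk : 4 ≤ k) (hp : IsIndPath G k p) :
    k ≤ Fintype.card V := by
  have key : ∀ i j, i < j → j < k → p i ≠ p j := by
    intro i j hij hj h
    rcases Nat.lt_or_ge (j + 1) k with h1 | h1
    · have h2 := hp i (j + 1) (by omega) h1
      rw [h, hp j (j + 1) (by omega) h1] at h2
      omega
    · have h2 := hp i (j - 1) (by omega) (by omega)
      rw [h, hp j (j - 1) (by omega) (by omega)] at h2
      have h3 := hp i (i - 1) (by omega) (by omega)
      rw [h, hp j (i - 1) (by omega) (by omega)] at h3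
      omega
  have := Fintype.card_le_of_injective (fun i : Fin k => p i) fun i j h => by
    by_contra hne
    rcases lt_or_gt_of_ne hne with h' | h'
    · exact key i j h' j.2 h
    · exact key j i h' i.2 h.symm
  simpa using this

theorem IsIndPath.color (hc : ∀ u v, G.Adj u v → c u ≠ c v) (hp : IsIndPath G k p) {i j : ℕ}
    (hi : i < k) (hj : j < k) : c (p i) = c (p j) ↔ i % 2 = j % 2 := by
  have key : ∀ i, i < k → (c (p i) = c (p 0) ↔ i % 2 = 0) := by
    intro i
    induction i with
    | zero => simp
    | succ i ih =>
      intro hi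
      have h1 := ih (by omega)
      have h2 := hc _ _ ((hp i (i + 1) (by omega) hi).2 (.inl rfl))
      have h3 : c (p (i + 1)) = c (p 0) ↔ ¬ c (p i) = c (p 0) := by
        cases h : c (p (i + 1)) <;> cases h' : c (p i) <;> cases h'' : c (p 0) <;> simp_all
      rw [h3, h1]
      omega
  have h1 := key i hi
  have h2 := key j hj
  have h3 : c (p i) = c (p j) ↔ (c (p i) = c (p 0) ↔ c (p j) = c (p 0)) := by
    cases h : c (p i) <;> cases h' : c (p j) <;> cases h'' : c (p 0) <;> simp_all
  rw [h3, h1, h2]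
  omega

/-- A non-dominating induced path on at least five vertices can be extended. -/
theorem IsIndPath.extend (hS : ClawFree G) (hk : 5 ≤ k) (hp : IsIndPath G k p) {w u : V}
    (hwu : G.Adj w u) (hu : ∀ i < k, ¬ G.Adj u (p i)) {i₀ : ℕ} (hi₀ : i₀ < k)
    (hw : G.Adj w (p i₀)) : ∃ p', IsIndPath G (k + 2) p' := by
  have hu' : ∀ i < k, ¬ G.Adj (p i) u := fun i hi h => hu i hi h.symm
  -- Claws centred on the path with long leg `w, u` propagate neighbours of `w` by two steps; claws
  -- centred at `w` with short leg `u` forbid the pairs so produced. Hence `w` sees one end only,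
  -- and `u, w` prolong the path there.
  have c1 : ∀ i, 1 ≤ i → i + 2 < k → G.Adj w (p i) → G.Adj w (p (i + 2)) := by
    intro i h1 h2 hi
    by_contra hcon
    refine hS (p i) (p (i - 1)) (p (i + 1)) (p (i + 2)) w u ?_ ?_ hi.symm ?_ hwu ?_
      (hu' _ (by omega)) (hu' _ (by omega)) hcon (hu' _ (by omega)) <;>
      rw [hp _ _ (by omega) (by omega)] <;> omega
  have c2 : ∀ i, 2 ≤ i → i + 1 < k → G.Adj w (p i) → G.Adj w (p (i - 2)) := by
    intro i h1 h2 hi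
    by_contra hcon
    refine hS (p i) (p (i + 1)) (p (i - 1)) (p (i - 2)) w u ?_ ?_ hi.symm ?_ hwu ?_
      (hu' _ (by omega)) (hu' _ (by omega)) hcon (hu' _ (by omega)) <;>
      rw [hp _ _ (by omega) (by omega)] <;> omega
  have c3 : ∀ i j, i + 4 ≤ j → j < k → G.Adj w (p i) → ¬ G.Adj w (p j) := by
    intro i j hij hj hi hj'
    refine hS w u (p i) (p (i + 1)) (p j) (p (j - 1)) hwu hi hj' ?_ ?_ (hu _ (by omega))
      (hu _ (by omega)) ?_ ?_ ?_ <;> rw [hp _ _ (by omega) (by omega)] <;> omega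
  have c4 : ∀ i, 1 ≤ i → i + 3 < k → G.Adj w (p i) → ¬ G.Adj w (p (i + 2)) := by
    intro i h1 h2 hi hi2
    refine hS w u (p i) (p (i - 1)) (p (i + 2)) (p (i + 3)) hwu hi hi2 ?_ ?_ (hu _ (by omega))
      (hu _ (by omega)) ?_ ?_ ?_ <;> rw [hp _ _ (by omega) (by omega)] <;> omega
  have hends : ∀ i, i < k → G.Adj w (p i) → i = 0 ∨ i + 1 = k := by
    intro i hi h
    by_contra hcon
    rcases Nat.lt_or_ge (i + 2) k with h1 | h1
    · have h2 := c1 i (by omega) h1 h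
      rcases Nat.lt_or_ge 1 i with h3 | h3
      · have h4 := c2 i h3 (by omega) h
        exact c3 (i - 2) (i + 2) (by omega) h1 h4 h2
      · exact c4 i (by omega) (by omega) h h2
    · have h2 := c2 i (by omega) (by omega) h
      refine c4 (i - 2) (by omega) (by omega) h2 ?_
      rwa [show i - 2 + 2 = i by omega]
  have main : ∀ q : ℕ → V, IsIndPath G k q → (∀ i < k, ¬ G.Adj u (q i)) →
      (∀ i < k, G.Adj w (q i) ↔ i = 0) → ∃ p', IsIndPath G (k + 2) p' := by
    intro q hq hu hw
    refine ⟨_, (hq.cons hw).cons (w := u) fun i hi => ?_⟩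
    rcases Nat.eq_zero_or_pos i with rfl | hi'
    · simpa using hwu.symm
    · simp only [hi'.ne', if_false, iff_false]
      exact hu _ (by omega)
  rcases hends i₀ hi₀ hw with rfl | h
  · refine main p hp hu fun i hi => ⟨fun h => ?_, fun h => h ▸ hw⟩
    rcases hends i hi h with h' | h'
    · exact h'
    · exact absurd h (c3 0 i (by omega) hi hw)
  · refine main _ hp.reverse (fun i hi => hu _ (by omega)) fun i hi => ⟨fun h' => ?_, fun h' => ?_⟩
    · rcases hends _ (by omega) h' with h'' | h''
      · exact absurd hw (c3 _ i₀ (by omega) hi₀ h')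
      · omega
    · subst h'
      rwa [show k - 1 - 0 = i₀ by omega]

/-- A shortest path from `s` to `t` is prolonged by `s'` and `t'`. By the choice of `s`, a neighbour
of `s'` beyond `s` can only be the second vertex of the path, which would make a triangle; likewise
for `t'`. -/
theorem exists_isIndPath_of_dist {s t s' t' : V} (hG : G.Connected) (ht : TriFree G)
    (hs : G.Adj s s') (htt : G.Adj t t') (hst : ¬ G.Adj s t) (hst' : s ≠ t) (hss : ¬ G.Adj s' t')
    (h1 : G.dist s t ≤ G.dist s' t) (h2 : G.dist s t ≤ G.dist s t') :
    ∃ k p, IsIndPath G k p ∧ 5 ≤ k ∧ p 0 = s' ∧ p 1 = s ∧ p (k - 2) = t ∧ p (k - 1) = t' := by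
  obtain ⟨q, hq⟩ := hG.exists_walk_length_eq_dist s t
  set d := G.dist s t with hd
  have hd2 : 2 ≤ d := by
    have h0 : d ≠ 0 := fun h => hst' (hG.dist_eq_zero_iff.1 h)
    have h1 : d ≠ 1 := fun h => hst (SimpleGraph.dist_eq_one_iff_adj.1 h)
    omega
  have hl : ∀ i, i ≤ d → G.dist s (q.getVert i) ≤ i := fun i hi => by
    have := SimpleGraph.dist_le (q.take i)
    rw [SimpleGraph.Walk.take_length] at this
    omega
  have hr : ∀ i, i ≤ d → G.dist (q.getVert i) t ≤ d - i := fun i hi => by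
    have := SimpleGraph.dist_le (q.drop i)
    rw [SimpleGraph.Walk.drop_length] at this
    omega
  have hadj1 : ∀ {u v}, G.Adj u v → G.dist u v = 1 := fun h =>
    SimpleGraph.dist_eq_one_iff_adj.2 h
  have hpath : IsIndPath G (d + 1) q.getVert := by
    have key : ∀ i j, i < j → j < d + 1 → (G.Adj (q.getVert i) (q.getVert j) ↔ j = i + 1) := by
      intro i j hij hj
      constructor
      · intro h
        have := hl i (by omega)
        have := hr j (by omega)
        have := hadj1 h
        have := hG.dist_triangle (u := s) (v := q.getVert i) (w := t)
        have := hG.dist_triangle (u := q.getVert i) (v := q.getVert j) (w := t)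
        omega
      · rintro rfl
        exact q.adj_getVert_succ (by omega)
    intro i j hi hj
    rcases lt_trichotomy i j with h | rfl | h
    · rw [key i j h hj]; omega
    · simp
    · rw [G.adj_comm, key j i h hi]; omega
  have hq0 : q.getVert 0 = s := q.getVert_zero
  have hqd : q.getVert d = t := by rw [← hq]; exact q.getVert_length
  have hs' : ∀ i < d + 1, G.Adj s' (q.getVert i) ↔ i = 0 := by
    intro i hi
    constructor
    · intro h
      have := hr i (by omega)
      have := hadj1 h
      have := hG.dist_triangle (u := s') (v := q.getVert i) (w := t)
      by_contra h0
      obtain rfl : i = 1 := by omega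
      have h01 := q.adj_getVert_succ (i := 0) (by omega)
      rw [hq0] at h01
      exact ht _ _ _ h01 h.symm hs.symm
    · rintro rfl
      rw [hq0]
      exact hs.symm
  have ht' : ∀ i < d + 1, G.Adj t' (q.getVert i) ↔ i = d := by
    intro i hi
    constructor
    · intro h
      have := hl i (by omega)
      have := hadj1 h.symm
      have := hG.dist_triangle (u := s) (v := q.getVert i) (w := t')
      by_contra h0
      obtain rfl : i = d - 1 := by omega
      have h01 := q.adj_getVert_succ (i := d - 1) (by omega)
      rw [show d - 1 + 1 = d by omega, hqd] at h01
      exact ht _ _ _ h01 htt h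
    · rintro rfl
      rw [hqd]
      exact htt.symm
  have hp1 := (hpath.cons hs').reverse
  have hp2 := hp1.cons (w := t') (fun i hi => by
    rcases Nat.lt_or_ge i (d + 1) with h | h
    · simp only [show ¬ (d + 1 + 1 - 1 - i = 0) by omega, if_false]
      rw [ht' _ (by omega)]
      omega
    · simp only [show d + 1 + 1 - 1 - i = 0 by omega, if_true]
      have : ¬ G.Adj t' s' := fun h => hss h.symm
      simp only [this, false_iff]
      omega)
  refine ⟨_, _, hp2.reverse, by omega, ?_, ?_, ?_, ?_⟩
  · simp
  · simp
  · simp [← hqd]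
  · simp

/-- Joining the two edges of the gap at their closest ends gives an induced path with these edges at
its ends. If it has fewer than seven vertices, a claw with short leg `y₃` shows that `y₃` has no
neighbour on it; so it is not dominating and gains two vertices. -/
theorem exists_isIndPath_seven (hG : G.Connected) (ht : TriFree G) (hS : ClawFree G)
    (hc : ∀ u v, G.Adj u v → c u ≠ c v) (hgap : HasTwoEdgesAndVertex G c) :
    ∃ p, IsIndPath G 7 p := by
  obtain ⟨x₁, x₂, y₁, y₂, y₃, h1, h2, hx, hy, n1, n2, n3, n4⟩ := hgap
  have c1 := hc _ _ h1
  have c2 := hc _ _ h2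
  have nx : ¬ G.Adj x₁ x₂ := fun h => hc _ _ h hx
  have ny : ¬ G.Adj y₁ y₂ := fun h => hc _ _ h (by
    cases h : c x₁ <;> cases h' : c y₁ <;> cases h'' : c y₂ <;> simp_all)
  have ny1 : ¬ G.Adj y₁ y₃ := fun h => hc _ _ h (by
    cases h : c x₁ <;> cases h' : c y₁ <;> cases h'' : c y₃ <;> simp_all)
  have ny2 : ¬ G.Adj y₂ y₃ := fun h => hc _ _ h (by
    cases h : c x₁ <;> cases h' : c y₂ <;> cases h'' : c y₃ <;> simp_all)
  obtain ⟨k, p, hp, hk, e0, e1, e2, e3⟩ : ∃ k p, IsIndPath G k p ∧ 5 ≤ k ∧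
      ¬ G.Adj (p 0) y₃ ∧ ¬ G.Adj (p 1) y₃ ∧ ¬ G.Adj (p (k - 2)) y₃ ∧ ¬ G.Adj (p (k - 1)) y₃ := by
    have main : ∀ s s' t t', G.Adj s s' → G.Adj t t' → ¬ G.Adj s t → ¬ G.Adj s t' →
        ¬ G.Adj s' t' → G.dist s t ≤ G.dist s' t → G.dist s t ≤ G.dist s t' →
        ¬ G.Adj s y₃ → ¬ G.Adj s' y₃ → ¬ G.Adj t y₃ → ¬ G.Adj t' y₃ → ∃ k p, IsIndPath G k p ∧
        5 ≤ k ∧ ¬ G.Adj (p 0) y₃ ∧ ¬ G.Adj (p 1) y₃ ∧ ¬ G.Adj (p (k - 2)) y₃ ∧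
        ¬ G.Adj (p (k - 1)) y₃ := by
      intro s s' t t' hs htt a1 a2 a3 d1 d2 b1 b2 b3 b4
      obtain ⟨k, p, hp, hk, e0, e1, e2, e3⟩ := exists_isIndPath_of_dist hG ht hs htt a1
        (fun h => a2 (h ▸ htt)) a3 d1 d2
      exact ⟨k, p, hp, hk, by rwa [e0], by rwa [e1], by rwa [e2], by rwa [e3]⟩
    have n2' : ¬ G.Adj y₁ x₂ := fun h => n2 h.symm
    rcases le_total (G.dist x₁ x₂) (G.dist y₁ x₂) with h12 | h12 <;>
    rcases le_total (G.dist x₁ y₂) (G.dist y₁ y₂) with h34 | h34 <;>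
    rcases le_total (G.dist x₁ x₂) (G.dist x₁ y₂) with h13 | h13 <;>
    rcases le_total (G.dist y₁ x₂) (G.dist y₁ y₂) with h24 | h24 <;>
    first
    | exact main x₁ y₁ x₂ y₂ h1 h2 nx n1 ny (by omega) (by omega) n3 ny1 n4 ny2
    | exact main x₁ y₁ y₂ x₂ h1 h2.symm n1 nx n2' (by omega) (by omega) n3 ny1 ny2 n4
    | exact main y₁ x₁ x₂ y₂ h1.symm h2 n2' ny n1 (by omega) (by omega) ny1 n3 n4 ny2
    | exact main y₁ x₁ y₂ x₂ h1.symm h2.symm ny n2' nx (by omega) (by omega) ny1 n3 ny2 n4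
  by_cases hk7 : 7 ≤ k
  · exact ⟨p, hp.mono hk7⟩
  have hiso : ∀ i < k, ¬ G.Adj y₃ (p i) := by
    intro i hi h
    have hne : i ≠ 0 ∧ i ≠ 1 ∧ i ≠ k - 2 ∧ i ≠ k - 1 := by
      refine ⟨?_, ?_, ?_, ?_⟩ <;> rintro rfl <;> simp_all [G.adj_comm]
    have f1 : ¬ G.Adj y₃ (p (i - 2)) := by
      rcases (by omega : i - 2 = 0 ∨ i - 2 = 1) with h | h <;> rw [h, G.adj_comm] <;> assumption
    have f2 : ¬ G.Adj y₃ (p (i + 2)) := by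
      rcases (by omega : i + 2 = k - 2 ∨ i + 2 = k - 1) with h | h <;> rw [h, G.adj_comm] <;>
        assumption
    refine hS (p i) y₃ (p (i - 1)) (p (i - 2)) (p (i + 1)) (p (i + 2)) h.symm ?_ ?_ ?_ ?_ f1 f2
      ?_ ?_ ?_ <;> rw [hp _ _ (by omega) (by omega)] <;> omega
  by_contra hcon
  have hdom : ∀ v, ∃ i < k, G.Adj v (p i) := by
    intro v
    have hr := (SimpleGraph.reachable_iff_reflTransGen (p 0) v).1 (hG.preconnected _ v)
    induction hr with
    | refl => exact ⟨1, by omega, (hp 0 1 (by omega) (by omega)).2 (.inl rfl)⟩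
    | @tail w u _ hwu ih =>
      obtain ⟨i, hi, hw⟩ := ih
      by_contra hu
      push Not at hu
      obtain ⟨p', hp'⟩ := hp.extend hS hk hwu hu hi hw
      exact hcon ⟨p', hp'.mono (by omega)⟩
  obtain ⟨i, hi, h⟩ := hdom y₃
  exact hiso i hi h

end

section

variable {V : Type*} {G : SimpleGraph V} {k : ℕ} {p : ℕ → V} {c : V → Bool}

/-- A vertex with two far neighbours on an induced path closes a long induced cycle. -/
theorem IsIndPath.exists_adj_between (hcyc : ∀ n, 7 ≤ n → ∀ f : ZMod n → V, ¬ IsIndCycle G 1 f)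
    (hp : IsIndPath G k p) {w : V} {i j : ℕ} (hij : i + 5 ≤ j) (hj : j < k)
    (hwi : G.Adj w (p i)) (hwj : G.Adj w (p j)) : ∃ m, i < m ∧ m < j ∧ G.Adj w (p m) := by
  by_contra! hcon
  have : NeZero (j - i + 2) := ⟨by omega⟩
  refine hcyc (j - i + 2) (by omega) _ (isIndCycle_of_nat (by omega)
    (f := fun t => if t ≤ j - i then p (i + t) else w) fun a b hab hb => ?_)
  simp only [show a ≤ j - i by omega, if_true]
  rcases Nat.lt_or_ge (j - i) b with h | h
  · simp only [show ¬ b ≤ j - i by omega, if_false]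
    obtain rfl : b = j - i + 1 := by omega
    rcases Nat.eq_zero_or_pos a with rfl | ha
    · rw [iff_true_left (by simpa using hwi.symm)]
      omega
    · rcases (by omega : a = j - i ∨ a < j - i) with rfl | ha'
      · rw [show i + (j - i) = j by omega]
        rw [iff_true_left hwj.symm]
        omega
      · have := hcon (i + a) (by omega) (by omega)
        rw [G.adj_comm]
        simp only [this, false_iff]
        omega
  · simp only [h, if_true]
    rw [hp _ _ (by omega) (by omega)]
    omega

/-- With respect to a longest induced path, a vertex with a neighbour on the path has the
neighbours of some vertex of the path. -/
theorem IsIndPath.exists_type (hS : ClawFree G) (hc : ∀ u v, G.Adj u v → c u ≠ c v)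
    (hcyc : ∀ n, 7 ≤ n → ∀ f : ZMod n → V, ¬ IsIndCycle G 1 f) (hk : 7 ≤ k)
    (hmax : ∀ p', ¬ IsIndPath G (k + 1) p') (hp : IsIndPath G k p) {w : V} {i₀ : ℕ} (hi₀ : i₀ < k)
    (hw : G.Adj w (p i₀)) : ∃ j < k, ∀ i < k, G.Adj w (p i) ↔ j = i + 1 ∨ i = j + 1 := by
  classical
  have hpar : ∀ i j, i < k → j < k → G.Adj w (p i) → G.Adj w (p j) → i % 2 = j % 2 := by
    intro i j hi hj h1 h2
    rw [← hp.color hc hi hj]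
    have h1 := hc _ _ h1
    have h2 := hc _ _ h2
    cases h : c (p i) <;> cases h' : c (p j) <;> cases h'' : c w <;> simp_all
  -- If `w` has a neighbour beyond `p i`, then `p (i + 2)` is one: a gap of four is filled by a
  -- claw, a larger gap would close a long induced cycle. Distance four is excluded by `q5`, so at
  -- most two neighbours remain, two apart.
  have q1 : ∀ i, i + 4 < k → G.Adj w (p i) → G.Adj w (p (i + 4)) → G.Adj w (p (i + 2)) := by
    intro i hi h1 h2
    by_contra hcon
    rcases Nat.lt_or_ge (i + 5) k with h | h
    · refine hS (p (i + 4)) (p (i + 5)) (p (i + 3)) (p (i + 2)) w (p i) ?_ ?_ h2.symm ?_ h1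
        ?_ ?_ ?_ hcon ?_ <;> rw [hp _ _ (by omega) (by omega)] <;> omega
    · refine hS (p i) (p (i - 1)) (p (i + 1)) (p (i + 2)) w (p (i + 4)) ?_ ?_ h1.symm ?_ h2
        ?_ ?_ ?_ hcon ?_ <;> rw [hp _ _ (by omega) (by omega)] <;> omega
  have q3 : ∀ i j, i < j → j < k → G.Adj w (p i) → G.Adj w (p j) → G.Adj w (p (i + 2)) := by
    intro i j
    induction j using Nat.strong_induction_on with
    | _ j ih =>
      intro hij hj hi hwj
      have := hpar i j (by omega) hj hi hwj
      rcases (by omega : j = i + 2 ∨ j = i + 4 ∨ i + 5 ≤ j) with rfl | rfl | h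
      · exact hwj
      · exact q1 i hj hi hwj
      · obtain ⟨m, h1, h2, h3⟩ := hp.exists_adj_between hcyc h hj hi hwj
        exact ih m h2 h1 (by omega) hi h3
  have q4 : ∀ i, i + 6 < k → G.Adj w (p i) → G.Adj w (p (i + 4)) → ¬ G.Adj w (p (i + 6)) := by
    intro i hi h1 h2 h3
    refine hS w (p (i + 6)) (p i) (p (i + 1)) (p (i + 4)) (p (i + 3)) h3 h1 h2 ?_ ?_ ?_ ?_ ?_ ?_ ?_
      <;> rw [hp _ _ (by omega) (by omega)] <;> omega
  have q5 : ∀ i, i + 4 < k → G.Adj w (p i) → ¬ G.Adj w (p (i + 4)) := by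
    intro i hi h1 h3
    have h2 := q1 i hi h1 h3
    rcases Nat.lt_or_ge (i + 6) k with h | h
    · refine hS (p (i + 4)) (p (i + 3)) (p (i + 5)) (p (i + 6)) w (p i) ?_ ?_ h3.symm ?_ h1
        ?_ ?_ ?_ (q4 i h h1 h3) ?_ <;> rw [hp _ _ (by omega) (by omega)] <;> omega
    rcases Nat.lt_or_ge i 2 with h' | h'
    · refine hS w (p (i + 2)) (p i) (p (i - 1)) (p (i + 4)) (p (i + 5)) h2 h1 h3 ?_ ?_ ?_ ?_ ?_
        ?_ ?_ <;> rw [hp _ _ (by omega) (by omega)] <;> omega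
    · refine hS (p i) (p (i + 1)) (p (i - 1)) (p (i - 2)) w (p (i + 4)) ?_ ?_ h1.symm ?_ h3
        ?_ ?_ ?_ (fun h4 => ?_) ?_
      on_goal 7 =>
        have := q4 (i - 2) (by omega) h4
        rw [show i - 2 + 4 = i + 2 by omega, show i - 2 + 6 = i + 4 by omega] at this
        exact this h2 h3
      all_goals rw [hp _ _ (by omega) (by omega)]
      all_goals omega
  have hex : ∃ i, i < k ∧ G.Adj w (p i) := ⟨i₀, hi₀, hw⟩
  obtain ⟨hik, hwi⟩ := Nat.find_spec hex
  have hmin : ∀ m, m < k → G.Adj w (p m) → Nat.find hex ≤ m := fun m h h' => Nat.find_min' hex ⟨h, h'⟩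
  generalize Nat.find hex = i at *
  by_cases hbig : ∃ j, i < j ∧ j < k ∧ G.Adj w (p j)
  · obtain ⟨j, hij, hjk, hwj⟩ := hbig
    have h2 := q3 i j hij hjk hwi hwj
    have := hpar i j hik hjk hwi hwj
    refine ⟨i + 1, by omega, fun m hm => ⟨fun h => ?_, ?_⟩⟩
    · have h3 := hmin m hm h
      by_contra hcon
      have := hpar i m hik hm hwi h
      have h4 := q3 (i + 2) m (by omega) hm h2 h
      exact q5 i (by omega) hwi h4
    · rintro (h | rfl)
      · rwa [← Nat.succ_injective h]
      · exact h2
  · push Not at hbig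
    have huniq : ∀ m < k, G.Adj w (p m) ↔ m = i := fun m hm => ⟨fun h => by
      have := hmin m hm h
      by_contra hne
      exact hbig m (by omega) hm h, fun h => h ▸ hwi⟩
    -- A single neighbour at an end would prolong the longest path. One that is neither second nor
    -- last but one is the centre of a claw with short leg `w`.
    have hi0 : i ≠ 0 := by
      rintro rfl
      exact hmax _ (hp.cons huniq)
    have hik' : i + 1 ≠ k := by
      intro h
      refine hmax _ (hp.reverse.cons (w := w) fun m hm => ?_)
      rw [huniq _ (by omega)]
      omega
    have hi12 : i = 1 ∨ i + 2 = k := by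
      by_contra hcon
      have a1 := fun h => hbig (i + 2) (by omega) (by omega) h
      have a2 := mt (hmin (i - 2) (by omega)) (by omega)
      refine hS (p i) w (p (i + 1)) (p (i + 2)) (p (i - 1)) (p (i - 2)) hwi.symm ?_ ?_ ?_ ?_
        a1 a2 ?_ ?_ ?_ <;> rw [hp _ _ (by omega) (by omega)] <;> omega
    rcases hi12 with rfl | h
    · exact ⟨0, by omega, fun m hm => by rw [huniq m hm]; omega⟩
    · exact ⟨i + 1, by omega, fun m hm => by rw [huniq m hm]; omega⟩

theorem IsIndPath.update (hp : IsIndPath G k p) {a : ℕ} {x : V}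
    (hx : ∀ i < k, G.Adj x (p i) ↔ a = i + 1 ∨ i = a + 1) :
    IsIndPath G k (Function.update p a x) := by
  intro i j hik hjk
  by_cases hi : i = a <;> by_cases hj : j = a
  · simp [hi, hj]
  · subst hi
    simp only [update_self, update_of_ne hj, hx j hjk]
    tauto
  · subst hj
    simp only [update_self, update_of_ne hi, G.adj_comm, hx i hik]
  · simp only [update_of_ne hi, update_of_ne hj, hp i j hik hjk]

/-- As for cycles, with the claw laid towards whichever side of `j` leaves three more vertices of
the path. -/
theorem IsIndPath.not_adj_of_not_dominated (hS : ClawFree G) (hk : 7 ≤ k)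
    (hp : IsIndPath G k p) {w u : V} {j : ℕ} (hj : j < k)
    (hw : ∀ i < k, G.Adj w (p i) ↔ j = i + 1 ∨ i = j + 1) (hu : ∀ i < k, ¬ G.Adj u (p i)) :
    ¬ G.Adj w u := by
  intro hwu
  have hu' : ∀ i < k, ¬ G.Adj (p i) u := fun i hi h => hu i hi h.symm
  rcases Nat.lt_or_ge (j + 3) k with h | h
  · refine hS (p (j + 1)) (p j) (p (j + 2)) (p (j + 3)) w u ?_ ?_ ?_ ?_ hwu ?_ (hu' _ (by omega))
      (hu' _ (by omega)) ?_ (hu' _ (by omega)) <;>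
      first
      | rw [hp _ _ (by omega) (by omega)]; omega
      | rw [G.adj_comm, hw _ (by omega)]; omega
      | rw [hw _ (by omega)]; omega
  · refine hS (p (j - 1)) (p j) (p (j - 2)) (p (j - 3)) w u ?_ ?_ ?_ ?_ hwu ?_ (hu' _ (by omega))
      (hu' _ (by omega)) ?_ (hu' _ (by omega)) <;>
      first
      | rw [hp _ _ (by omega) (by omega)]; omega
      | rw [G.adj_comm, hw _ (by omega)]; omega
      | rw [hw _ (by omega)]; omega

/-- With `x` in place of `p a`, `y` gets a type `b'` on the new path. It has a neighbour there:
otherwise `p a` was its only neighbour on the old path, and `p a`, of type `a` on the new one, would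
see an undominated vertex. -/
theorem IsIndPath.exists_update_type (hS : ClawFree G) (hc : ∀ u v, G.Adj u v → c u ≠ c v)
    (hcyc : ∀ n, 7 ≤ n → ∀ f : ZMod n → V, ¬ IsIndCycle G 1 f) (hk : 7 ≤ k)
    (hmax : ∀ p', ¬ IsIndPath G (k + 1) p') (hp : IsIndPath G k p) {x y : V} {a b : ℕ}
    (ha : a < k) (hb : b < k) (hx : ∀ i < k, G.Adj x (p i) ↔ a = i + 1 ∨ i = a + 1)
    (hy : ∀ i < k, G.Adj y (p i) ↔ b = i + 1 ∨ i = b + 1) :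
    ∃ b' < k, (G.Adj y x ↔ b' = a + 1 ∨ a = b' + 1) ∧
      ∀ i < k, i ≠ a → ((b = i + 1 ∨ i = b + 1) ↔ (b' = i + 1 ∨ i = b' + 1)) := by
  have hp' := hp.update hx
  have hself : Function.update p a x a = x := update_self ..
  have hoff : ∀ i, i ≠ a → Function.update p a x i = p i := fun i hi => update_of_ne hi ..
  obtain ⟨i₀, hi₀, h₀⟩ : ∃ i < k, G.Adj y (Function.update p a x i) := by
    by_contra! hcon
    have hpa : ∀ i < k, G.Adj (p a) (Function.update p a x i) ↔ a = i + 1 ∨ i = a + 1 := by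
      intro i hi
      by_cases hia : i = a
      · rw [hia, hself, G.adj_comm, hx a ha]
      · rw [hoff i hia, hp a i ha hi]
        omega
    refine hp'.not_adj_of_not_dominated hS hk ha hpa hcon ?_
    rw [G.adj_comm, hy a ha]
    by_contra hna
    rcases Nat.eq_zero_or_pos b with rfl | hb0
    · have := hcon 1 (by omega)
      rw [hoff 1 (by omega), hy 1 (by omega)] at this
      omega
    · have := hcon (b - 1) (by omega)
      rw [hoff _ (by omega), hy _ (by omega)] at this
      omega
  obtain ⟨b', hb', h'⟩ := hp'.exists_type hS hc hcyc hk hmax hi₀ h₀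
  refine ⟨b', hb', ?_, fun i hi hia => ?_⟩
  · rw [← h' a ha, hself]
  · rw [← h' i hi, hoff i hia, hy i hi]

/-- One substitution can be ambiguous near the ends: types `0` and `2` agree away from position `3`.
Exchanging the roles of `x` and `y` removes the ambiguity. -/
theorem IsIndPath.adj_iff (hS : ClawFree G) (hc : ∀ u v, G.Adj u v → c u ≠ c v)
    (hcyc : ∀ n, 7 ≤ n → ∀ f : ZMod n → V, ¬ IsIndCycle G 1 f) (hk : 7 ≤ k)
    (hmax : ∀ p', ¬ IsIndPath G (k + 1) p') (hp : IsIndPath G k p) {x y : V} {a b : ℕ}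
    (ha : a < k) (hb : b < k) (hx : ∀ i < k, G.Adj x (p i) ↔ a = i + 1 ∨ i = a + 1)
    (hy : ∀ i < k, G.Adj y (p i) ↔ b = i + 1 ∨ i = b + 1) :
    G.Adj x y ↔ b = a + 1 ∨ a = b + 1 := by
  obtain ⟨b', hb', hyx, h1⟩ := hp.exists_update_type hS hc hcyc hk hmax ha hb hx hy
  obtain ⟨a', ha', hxy, h2⟩ := hp.exists_update_type hS hc hcyc hk hmax hb ha hy hx
  rw [hxy]
  rw [G.adj_comm, hxy] at hyx
  have e1 := h1 (b + 1)
  have e2 := h1 (b - 1)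
  have e3 := h1 (b' + 1)
  have e4 := h1 (b' - 1)
  have f1 := h2 (a + 1)
  have f2 := h2 (a - 1)
  have f3 := h2 (a' + 1)
  have f4 := h2 (a' - 1)
  omega

/-- A connected bipartite `S_{1,2,2}`-free graph with a long induced path but no long induced
cycle is a blow-up of a path. -/
theorem IsIndPath.hasWidth [Fintype V] (hG : G.Connected) (hS : ClawFree G)
    (hc : ∀ u v, G.Adj u v → c u ≠ c v)
    (hcyc : ∀ n, 7 ≤ n → ∀ f : ZMod n → V, ¬ IsIndCycle G 1 f) (hp : IsIndPath G 7 p) :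
    HasWidth G 3 := by
  classical
  obtain ⟨k, hk, ⟨q, hq⟩, hmax⟩ : ∃ k, 7 ≤ k ∧ (∃ q, IsIndPath G k q) ∧
      ∀ q, ¬ IsIndPath G (k + 1) q := by
    have hex : ∃ k, 7 ≤ k ∧ ∀ q, ¬ IsIndPath G (k + 1) q :=
      ⟨Fintype.card V + 7, by omega, fun q hq => by
        have := hq.length_le (by omega)
        omega⟩
    refine ⟨Nat.find hex, (Nat.find_spec hex).1, ?_, (Nat.find_spec hex).2⟩
    rcases (Nat.find_spec hex).1.lt_or_eq with h | h
    · have := Nat.find_min hex (m := Nat.find hex - 1) (by omega)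
      push Not at this
      obtain ⟨q, hq⟩ := this (by omega)
      rw [Nat.sub_add_cancel (by omega)] at hq
      exact ⟨q, hq⟩
    · rw [← h]
      exact ⟨p, hp⟩
  have hdom : ∀ v, ∃ j < k, ∀ i < k, G.Adj v (q i) ↔ j = i + 1 ∨ i = j + 1 := by
    intro v
    have hr := (SimpleGraph.reachable_iff_reflTransGen (q 0) v).1 (hG.preconnected _ v)
    induction hr with
    | refl => exact ⟨0, by omega, fun i hi => by rw [hq 0 i (by omega) hi]; omega⟩
    | @tail w u _ hwu ih =>
      obtain ⟨j, hj, hw⟩ := ih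
      by_contra hcon
      refine hq.not_adj_of_not_dominated hS hk hj hw (fun i hi h => hcon ?_) hwu
      exact hq.exists_type hS hc hcyc hk hmax hi h
  choose φ hφk hφ using hdom
  have hadj : ∀ x y, G.Adj x y ↔ φ y = φ x + 1 ∨ φ x = φ y + 1 := fun x y =>
    hq.adj_iff hS hc hcyc hk hmax (hφk x) (hφk y) (hφ x) (hφ y)
  refine HasWidth.of_blowup φ (fun x x' y h hxy => ?_) (fun x y hxy hlt => ?_) fun x y hxy h => ?_
  · rwa [hadj, ← h, ← hadj]
  · rw [hadj] at hxy
    omega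
  · rw [hadj] at hxy
    omega

/-- Connected `(K_3, C_5, S_{1,2,2})`-free graphs have linear rank-width at most `3`. -/
theorem hasWidth_of_pentaFree [Fintype V] (hG : G.Connected) (ht : TriFree G) (hS : ClawFree G)
    (h5 : G.IsBipartite ∨ PentaFree G) : HasWidth G 3 := by
  have h5' : PentaFree G := by
    rcases h5 with hb | h5
    · obtain ⟨col⟩ := hb
      intro x₁ x₂ x₃ x₄ x₅ e1 e2 e3 e4 e5
      have := col.valid e1
      have := col.valid e2
      have := col.valid e3
      have := col.valid e4
      have := col.valid e5
      omega
    · exact h5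
  by_cases hcyc : ∃ n, 7 ≤ n ∧ ∃ f : ZMod n → V, IsIndCycle G 1 f
  · obtain ⟨n, hn, f, hf⟩ := hcyc
    exact hf.hasWidth hG.preconnected hS h5' hn
  push Not at hcyc
  have hb : G.IsBipartite := by
    by_contra hb
    obtain ⟨n, f, hn, hf⟩ := exists_isIndCycle_of_not_isBipartite ht h5' hb
    exact hcyc n hn f hf
  obtain ⟨col⟩ := hb
  have hc : ∀ u v, G.Adj u v → decide (col u = 0) ≠ decide (col v = 0) := by
    intro u v huv h
    have := col.valid huv
    rw [decide_eq_decide] at h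
    omega
  by_cases hgap : HasTwoEdgesAndVertex G fun v => decide (col v = 0)
  · obtain ⟨p, hp⟩ := exists_isIndPath_seven hG ht hS hc hgap
    exact hp.hasWidth hG hS hc hcyc
  · exact HasWidth.of_not_hasTwoEdgesAndVertex hc hgap

end

/-! ### Blocks of three chain graphs -/

section Blocks

variable {V : Type*} {G : SimpleGraph V}

theorem TriFree.not_adj (ht : TriFree G) {a b c : V} (h : G.Adj a b) (h' : G.Adj b c) :
    ¬ G.Adj a c := fun h'' => ht _ _ _ h h' h''.symm

/-- A graph whose vertices are labelled by `20` labels, such that the adjacency is determined by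
the labels except inside five blocks, each of which consists of three pairwise independent chain
graphs without cyclic triples. -/
theorem HasWidth.of_blocks [Fintype V] (ht : TriFree G) (l : V → ZMod 5 × Option (ZMod 3))
    (hconst : ∀ x x' y, l x = l x' → G.Adj x y →
      (∀ b k m, k ≠ m → l x = (b, some k) → l y ≠ (b, some m)) → G.Adj x' y)
    (htriple : ∀ b u v w, l u = (b, some 0) → l v = (b, some 1) → l w = (b, some 2) →
      G.Adj u v ∨ G.Adj v w ∨ G.Adj u w)
    (hchain : ∀ b k u v y z, l u = (b, some k) → l v = (b, some k) → l y = (b, some (k + 1)) →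
      l z = (b, some (k + 1)) → G.Adj u y → G.Adj v z → G.Adj u z ∨ G.Adj v y) :
    HasWidth G 20 := by
  -- Cyclically, edges point one part down and non-edges one part up. Directed triangles would be
  -- triangles or independent triples of `G`, and directed 4-cycles would violate the chain
  -- condition.
  let R : V → V → Prop := fun u w => ∃ b k m, l u = (b, some k) ∧ l w = (b, some m) ∧
    (k = m + 1 ∧ G.Adj u w ∨ m = k + 1 ∧ ¬ G.Adj u w)
  have z1 : ∀ k m : ZMod 3, k ≠ m → k = m + 1 ∨ m = k + 1 := by decide
  have z2 : ∀ k m : ZMod 3, k = m + 1 → k ≠ m ∧ m ≠ k + 1 := by decide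
  have z3 : ∀ k m n : ZMod 3, k = m + 1 → m = n + 1 → n = k + 1 := by decide
  have z4 : ∀ k m n : ZMod 3, k = m + 1 → n = m + 1 → k = n := by decide
  have z5 : ∀ k m n : ZMod 3, m = k + 1 → m = n + 1 → k = n := by decide
  have hR : ∀ {b k m u w}, l u = (b, some k) → l w = (b, some m) → R u w →
      (k = m + 1 ∧ G.Adj u w ∨ m = k + 1 ∧ ¬ G.Adj u w) := by
    rintro b k m u w hu hw ⟨b', k', m', hu', hw', h⟩
    rw [hu] at hu'
    rw [hw] at hw'
    obtain ⟨rfl, rfl⟩ : b = b' ∧ k = k' := by simpa using hu'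
    obtain rfl : m = m' := by simpa using hw'
    exact h
  have htriple' : ∀ b k m n u v w, m = k + 1 → n = m + 1 → l u = (b, some k) → l v = (b, some m) →
      l w = (b, some n) → G.Adj u v ∨ G.Adj v w ∨ G.Adj u w := by
    intro b k m n u v w hm hn hu hv hw
    have : k = 0 ∧ m = 1 ∧ n = 2 ∨ k = 1 ∧ m = 2 ∧ n = 0 ∨ k = 2 ∧ m = 0 ∧ n = 1 := by
      clear hu hv hw
      decide +revert
    rcases this with ⟨rfl, rfl, rfl⟩ | ⟨rfl, rfl, rfl⟩ | ⟨rfl, rfl, rfl⟩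
    · exact htriple b u v w hu hv hw
    · rcases htriple b w u v hw hu hv with h | h | h
      · exact .inr (.inr h.symm)
      · exact .inl h
      · exact .inr (.inl h.symm)
    · rcases htriple b v w u hv hw hu with h | h | h
      · exact .inr (.inl h)
      · exact .inr (.inr h.symm)
      · exact .inl h.symm
  obtain ⟨φ, hφ⟩ := exists_key_of_tournament l R
    (by
      rintro u v ⟨b, k, m, hu, hv, h⟩ huv
      rw [hu, hv] at huv
      have huv : k = m := by simpa using huv
      rcases h with ⟨h, -⟩ | ⟨h, -⟩
      · exact (z2 _ _ h).1 huv
      · exact (z2 _ _ h).1 huv.symm)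
    (by
      rintro u v ⟨b, k, m, hu, hv, h⟩ hvu
      have h' := hR hv hu hvu
      rcases h with ⟨h, ha⟩ | ⟨h, ha⟩ <;> rcases h' with ⟨h', ha'⟩ | ⟨h', ha'⟩
      · exact (z2 _ _ h).2 h'
      · exact ha' ha.symm
      · exact ha ha'.symm
      · exact (z2 _ _ h).2 h')
    (by
      rintro u v w ⟨b, k, m, hu, hv, h⟩ ⟨b', k', n, hv', hw, h'⟩ huw
      rw [hv] at hv'
      obtain ⟨rfl, rfl⟩ : b = b' ∧ m = k' := by simpa using hv'
      rw [hu, hw] at huw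
      have huw : k ≠ n := by simpa using huw
      refine ⟨b, k, n, hu, hw, ?_⟩
      rcases h with ⟨h, ha⟩ | ⟨h, ha⟩ <;> rcases h' with ⟨h', ha'⟩ | ⟨h', ha'⟩
      · exact .inr ⟨z3 _ _ _ h h', ht.not_adj ha ha'⟩
      · exact absurd (z4 _ _ _ h h') huw
      · exact absurd (z5 _ _ _ h h') huw
      · refine .inl ⟨z3 _ _ _ h' h, ?_⟩
        rcases htriple' b k m n u v w h h' hu hv hw with h1 | h1 | h1
        · exact absurd h1 ha
        · exact absurd h1 ha'
        · exact h1)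
    (by
      rintro u c v w ⟨b, k, m, hu, hc, h⟩ hcv hvw huv hcw
      rw [hu] at huv
      rw [hc] at hcw
      have h' := hR hc huv.symm hcv
      have h'' := hR huv.symm hcw.symm hvw
      refine ⟨b, k, m, hu, hcw.symm, ?_⟩
      rcases h with ⟨h, ha⟩ | ⟨h, ha⟩
      · have h1 : ¬ G.Adj c v := by
          rcases h' with h' | h'
          · exact absurd h'.1 (z2 _ _ h).2
          · exact h'.2
        have h2 : G.Adj v w := by
          rcases h'' with h'' | h''
          · exact h''.2
          · exact absurd h''.1 (z2 _ _ h).2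
        subst h
        refine .inl ⟨rfl, ?_⟩
        rcases hchain b m c w u v hc hcw.symm hu huv.symm ha.symm h2.symm with h3 | h3
        · exact absurd h3 h1
        · exact h3.symm
      · have h1 : G.Adj c v := by
          rcases h' with h' | h'
          · exact h'.2
          · exact absurd h'.1 (z2 _ _ h).2
        have h2 : ¬ G.Adj v w := by
          rcases h'' with h'' | h''
          · exact absurd h''.1 (z2 _ _ h).2
          · exact h''.2
        subst h
        refine .inr ⟨rfl, fun hcon => ?_⟩
        rcases hchain b k u v w c hu huv.symm hcw.symm hc hcon h1.symm with h3 | h3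
        · exact ha h3
        · exact h2 h3)
  have hRtot : ∀ b k m u w, k ≠ m → l u = (b, some k) → l w = (b, some m) → R u w ∨ R w u := by
    intro b k m u w hkm hu hw
    by_cases huw : G.Adj u w
    · rcases z1 k m hkm with h | h
      · exact .inl ⟨b, k, m, hu, hw, .inl ⟨h, huw⟩⟩
      · exact .inr ⟨b, m, k, hw, hu, .inl ⟨h, huw.symm⟩⟩
    · rcases z1 k m hkm with h | h
      · exact .inr ⟨b, m, k, hw, hu, .inr ⟨h, fun h => huw h.symm⟩⟩
      · exact .inl ⟨b, k, m, hu, hw, .inr ⟨h, huw⟩⟩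
  have e : ZMod 5 × Option (ZMod 3) ≃ Fin 20 := Fintype.equivFinOfCardEq (by decide)
  refine HasWidth.of_key φ fun X t h1 h2 => CutLE.of_types (fun v => some (e (l v)))
    (fun _ _ h => by simp at h) fun x hx x' hx' hl _ y hy hxy => ?_
  have hl : l x = l x' := by simpa using hl
  have hφy := not_lt.1 (mt (h1 y) hy)
  by_cases hexc : ∃ b k m, k ≠ m ∧ l x = (b, some k) ∧ l y = (b, some m)
  · obtain ⟨b, k, m, hkm, hbx, hby⟩ := hexc
    -- All vertices of `X` in part `k` precede `y`, so all arcs point to `y`: part `k` of `X` is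
    -- complete or anticomplete to `y`.
    have key : ∀ z ∈ X, l z = (b, some k) → (k = m + 1 ∧ G.Adj z y ∨ m = k + 1 ∧ ¬ G.Adj z y) :=
      fun z hz hlz => hR hlz hby ((hRtot b k m z y hkm hlz hby).resolve_right fun h => by
        have := hφ _ _ h
        have := h2 z hz
        omega)
    rcases key x hx hbx with ⟨h, -⟩ | ⟨-, h⟩
    · rcases key x' hx' (hl ▸ hbx) with ⟨-, h'⟩ | ⟨h', -⟩
      · exact h'
      · exact absurd h' (z2 _ _ h).2
    · exact absurd hxy h
  · push Not at hexc
    exact hconst x x' y hl hxy hexc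

end Blocks

/-! ### Clones and pendant vertices of a five-cycle -/

/-- The vertices `a, b, c, d, e` form a cycle. -/
structure IsPenta {V : Type*} (G : SimpleGraph V) (a b c d e : V) : Prop where
  ab : G.Adj a b
  bc : G.Adj b c
  cd : G.Adj c d
  de : G.Adj d e
  ea : G.Adj e a

section Penta

variable {V : Type*} {G : SimpleGraph V} {a b c d e : V}

theorem IsPenta.rotate (h : IsPenta G a b c d e) : IsPenta G b c d e a :=
  ⟨h.bc, h.cd, h.de, h.ea, h.ab⟩

theorem IsPenta.reverse (h : IsPenta G a b c d e) : IsPenta G a e d c b :=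
  ⟨h.ea.symm, h.de.symm, h.cd.symm, h.bc.symm, h.ab.symm⟩

/-- A clone of `a` on the cycle `a, b, c, d, e`: a vertex adjacent to both `e` and `b`. -/
structure IsClone (G : SimpleGraph V) (e b x : V) : Prop where
  left : G.Adj x e
  right : G.Adj x b

/-- A pendant vertex at `a` on the cycle `a, b, c, d, e`: a vertex adjacent to `a`, but not to `c`
or `d`. -/
structure IsPendant (G : SimpleGraph V) (a c d x : V) : Prop where
  adj : G.Adj x a
  left : ¬ G.Adj x c
  right : ¬ G.Adj x d

theorem IsClone.symm {x : V} (h : IsClone G e b x) : IsClone G b e x := ⟨h.2, h.1⟩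

theorem IsPendant.symm {x : V} (h : IsPendant G a c d x) : IsPendant G a d c x := ⟨h.1, h.3, h.2⟩

theorem clone_or_pendant {u : V} (h : G.Adj u a) :
    IsClone G a c u ∨ IsClone G d a u ∨ IsPendant G a c d u := by
  by_cases h1 : G.Adj u c
  · exact .inl ⟨h, h1⟩
  by_cases h2 : G.Adj u d
  · exact .inr (.inl ⟨h2, h⟩)
  · exact .inr (.inr ⟨h, h1, h2⟩)

variable (ht : TriFree G) (hS : ClawFree G) (hP : IsPenta G a b c d e)
include ht hS hP

/-- Otherwise `b` is the centre of a claw with short leg `a` and long legs `c, d` and `x, u`. With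
the next lemma, connectivity makes the five-cycle dominating. -/
theorem IsPenta.clone_dominating {x u : V} (hx : IsClone G e b x)
    (hc : ¬ G.Adj u c) (hd : ¬ G.Adj u d) (ha : ¬ G.Adj u a) : ¬ G.Adj x u := by
  intro h
  obtain ⟨ab, bc, cd, de, ea⟩ := hP
  obtain ⟨xe, xb⟩ := hx
  refine hS b a c d x u ab.symm bc xb.symm cd h ?_ ?_ ?_ ?_ ?_ <;>
    grind [G.adj_comm, ht.not_adj]

theorem IsPenta.pendant_dominating {w u : V} (hw : IsPendant G a c d w)
    (hb : ¬ G.Adj u b) (hc : ¬ G.Adj u c) (he : ¬ G.Adj u e) : ¬ G.Adj w u := by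
  intro h
  obtain ⟨ab, bc, cd, de, ea⟩ := hP
  obtain ⟨wa, wc, wd⟩ := hw
  refine hS a e w u b c ea.symm wa.symm ab h bc ?_ ?_ ?_ ?_ ?_ <;>
    grind [G.adj_comm, ht.not_adj]

theorem IsPenta.not_adj_pendant_pendant {w u : V} (hw : IsPendant G a c d w)
    (hu : IsPendant G c e a u) : ¬ G.Adj w u := by
  intro h
  obtain ⟨ab, bc, cd, de, ea⟩ := hP
  obtain ⟨wa, wc, wd⟩ := hw
  obtain ⟨uc, ue, ua⟩ := hu
  refine hS a b w u e d ab wa.symm ea.symm h de.symm ?_ ?_ ?_ ?_ ?_ <;>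
    grind [G.adj_comm, ht.not_adj]

/-- With its mirror image this makes the pendants at two consecutive vertices complete or
anticomplete to each other. -/
theorem IsPenta.pendant_adj_pendant {w w' u : V} (hw : IsPendant G a c d w)
    (hw' : IsPendant G a c d w') (hu : IsPendant G b d e u) (h : G.Adj w u) : G.Adj w' u := by
  by_contra hcon
  obtain ⟨ab, bc, cd, de, ea⟩ := hP
  obtain ⟨wa, wc, wd⟩ := hw
  obtain ⟨wa', wc', wd'⟩ := hw'
  obtain ⟨ub, ud, ue⟩ := hu
  refine hS a w' w u e d wa'.symm wa.symm ea.symm h de.symm hcon wd' wd ?_ ?_ <;>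
    grind [G.adj_comm]

theorem IsPenta.clone_adj_pendant {x w : V} (hx : IsClone G e b x) (hw : IsPendant G a c d w) :
    G.Adj x w := by
  by_contra hcon
  obtain ⟨ab, bc, cd, de, ea⟩ := hP
  obtain ⟨xe, xb⟩ := hx
  obtain ⟨wa, wc, wd⟩ := hw
  refine hS b x a w c d xb.symm ab.symm bc wa.symm cd hcon ?_ ?_ ?_ ?_ <;>
    grind [G.adj_comm, ht.not_adj]

theorem IsPenta.clone_chain {x x' y y' : V} (hx : IsClone G e b x) (hx' : IsClone G e b x')
    (hy : IsClone G a c y) (hy' : IsClone G a c y') (h : G.Adj x y) (h' : G.Adj x' y') :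
    G.Adj x y' ∨ G.Adj x' y := by
  by_contra! hcon
  obtain ⟨ab, bc, cd, de, ea⟩ := hP
  obtain ⟨xe, xb⟩ := hx
  obtain ⟨xe', xb'⟩ := hx'
  obtain ⟨ya, yc⟩ := hy
  obtain ⟨ya', yc'⟩ := hy'
  refine hS e d x y x' y' de.symm xe.symm xe'.symm h h' ?_ ?_ hcon.1 hcon.2 ?_ <;>
    grind [G.adj_comm, ht.not_adj]

/-- A clone thus cannot miss clones of both neighbouring cycle vertices, so each clone has a defect
on at most one side and belongs to at most one block. -/
theorem IsPenta.clone_adj_or {x y z : V} (hx : IsClone G e b x) (hy : IsClone G a c y)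
    (hz : IsClone G b d z) : G.Adj x y ∨ G.Adj y z := by
  by_contra! hcon
  obtain ⟨ab, bc, cd, de, ea⟩ := hP
  obtain ⟨xe, xb⟩ := hx
  obtain ⟨ya, yc⟩ := hy
  obtain ⟨zb, zd⟩ := hz
  refine hS d z e x c y zd.symm de cd.symm xe.symm yc.symm ?_ ?_ ?_ ?_ ?_ <;>
    grind [G.adj_comm, ht.not_adj]

theorem IsPenta.clone_adj_clone_of_pendant {w x y : V} (hw : IsPendant G a c d w)
    (hx : IsClone G b d x) (hy : IsClone G a c y) (h : G.Adj w x) : G.Adj x y := by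
  by_contra hcon
  obtain ⟨ab, bc, cd, de, ea⟩ := hP
  obtain ⟨wa, wc, wd⟩ := hw
  obtain ⟨xb, xd⟩ := hx
  obtain ⟨ya, yc⟩ := hy
  refine hS a e w x y c ea.symm wa.symm ya.symm h yc ?_ ?_ ?_ ?_ ?_ <;>
    grind [G.adj_comm, ht.not_adj]

theorem IsPenta.pendant_triple {w x y : V} (hw : IsPendant G a c d w)
    (hx : IsClone G b d x) (hy : IsClone G c e y) : G.Adj w x ∨ G.Adj x y ∨ G.Adj w y := by
  by_contra! hcon
  obtain ⟨ab, bc, cd, de, ea⟩ := hP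
  obtain ⟨wa, wc, wd⟩ := hw
  obtain ⟨xb, xd⟩ := hx
  obtain ⟨yc, ye⟩ := hy
  refine hS e y a w d x ye.symm ea de.symm wa.symm xd.symm ?_ ?_ ?_ ?_ ?_ <;>
    grind [G.adj_comm, ht.not_adj]

theorem IsPenta.pendant_chain {w w' x x' : V} (hw : IsPendant G a c d w)
    (hw' : IsPendant G a c d w') (hx : IsClone G b d x) (hx' : IsClone G b d x')
    (h : G.Adj w x) (h' : G.Adj w' x') : G.Adj w x' ∨ G.Adj w' x := by
  by_contra! hcon
  obtain ⟨ab, bc, cd, de, ea⟩ := hP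
  obtain ⟨wa, wc, wd⟩ := hw
  obtain ⟨wa', wc', wd'⟩ := hw'
  obtain ⟨xb, xd⟩ := hx
  obtain ⟨xb', xd'⟩ := hx'
  refine hS a e w x w' x' ea.symm wa.symm wa'.symm h h' ?_ ?_ hcon.1 hcon.2 ?_ <;>
    grind [G.adj_comm, ht.not_adj]

/-- If `c` has the largest degree among its clones, then a clone of `c` with a neighbour that is
pendant at `a` has a non-neighbour among the clones of `d`. -/
theorem IsPenta.exists_not_adj [Finite V]
    (hmax : ∀ x, IsClone G b d x → (G.neighborSet x).ncard ≤ (G.neighborSet c).ncard) {w x : V}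
    (hw : IsPendant G a c d w) (hx : IsClone G b d x) (h : G.Adj w x) :
    ∃ y, IsClone G c e y ∧ ¬ G.Adj x y := by
  by_contra! hcon
  -- Otherwise `x` sees all neighbours of `c`, whether clones of `d`, clones of `b` or pendants at
  -- `c`, and `w` besides.
  refine absurd (hmax x hx) (not_le.2 (Set.ncard_lt_ncard ?_ (Set.toFinite _)))
  refine Set.ssubset_iff_of_subset ?_ |>.2 ⟨w, h.symm, fun h' => hw.left (G.symm.symm _ _ h')⟩
  intro u hu
  have hu : G.Adj u c := G.symm.symm _ _ hu
  rcases clone_or_pendant (c := e) (d := a) hu with h1 | h1 | h1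
  · exact hcon u h1
  · exact hP.clone_adj_clone_of_pendant ht hS hw hx h1 h
  · exact hP.rotate.rotate.clone_adj_pendant ht hS hx h1

end Penta

/-! ### Graphs with a five-cycle: the labelling -/

theorem zmod_five_add (i : ZMod 5) : i + 1 + 1 = i + 2 ∧ i + 1 + 2 = i + 3 ∧ i + 1 + 3 = i + 4 ∧
    i + 1 + 4 = i ∧ i + 2 + 1 = i + 3 ∧ i + 2 + 2 = i + 4 ∧ i + 2 + 3 = i ∧ i + 2 + 4 = i + 1 ∧
    i + 3 + 1 = i + 4 ∧ i + 3 + 2 = i ∧ i + 3 + 3 = i + 1 ∧ i + 3 + 4 = i + 2 ∧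
    i + 4 + 1 = i ∧ i + 4 + 2 = i + 1 ∧ i + 4 + 3 = i + 2 ∧ i + 4 + 4 = i + 3 := by
  decide +revert

theorem zmod_five_cases (i j : ZMod 5) :
    j = i ∨ j = i + 1 ∨ j = i + 2 ∨ j = i + 3 ∨ j = i + 4 := by
  decide +revert

/-- Replacing a cycle vertex by a clone yields another five-cycle; a cycle of maximal degree sum
therefore has maximal degree at each position. -/
theorem exists_max_penta {V : Type*} [Fintype V] {G : SimpleGraph V} (h : ¬ PentaFree G) :
    ∃ v : ZMod 5 → V, (∀ i, G.Adj (v i) (v (i + 1))) ∧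
      ∀ i x, IsClone G (v (i + 4)) (v (i + 1)) x →
        (G.neighborSet x).ncard ≤ (G.neighborSet (v i)).ncard := by
  classical
  let μ : (ZMod 5 → V) → ℕ := fun v => ∑ i, (G.neighborSet (v i)).ncard
  have hne : {v : ZMod 5 → V | ∀ i, G.Adj (v i) (v (i + 1))}.Nonempty := by
    unfold PentaFree at h
    push Not at h
    obtain ⟨a, b, c, d, e, h1, h2, h3, h4, h5, -⟩ := h
    refine ⟨(![a, b, c, d, e] : Fin 5 → V), fun i => ?_⟩
    have : i = 0 ∨ i = 1 ∨ i = 2 ∨ i = 3 ∨ i = 4 := by decide +revert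
    rcases this with rfl | rfl | rfl | rfl | rfl <;> assumption
  obtain ⟨v, hv, hmax⟩ := Set.exists_max_image _ μ (Set.toFinite _) hne
  refine ⟨v, hv, fun i x hx => ?_⟩
  have hle := hmax (Function.update v i x) fun j => by
    have h0 : ∀ j : ZMod 5, j + 1 ≠ j := by decide
    by_cases h1 : j = i
    · subst h1
      rw [update_self, update_of_ne (h0 j)]
      exact hx.right
    · by_cases h2 : j + 1 = i
      · subst h2
        rw [update_self, update_of_ne h1]
        have := hx.left.symm
        rwa [(zmod_five_add j).2.2.2.1] at this
      · rw [update_of_ne h1, update_of_ne h2]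
        exact hv j
  simp only [μ] at hle
  rw [← Finset.add_sum_erase _ _ (Finset.mem_univ i),
    ← Finset.add_sum_erase _ (fun j => (G.neighborSet (v j)).ncard) (Finset.mem_univ i),
    update_self, Finset.sum_congr rfl fun j hj => by
      rw [update_of_ne (Finset.ne_of_mem_erase hj)]] at hle
  omega

/-- Connected `(K_3, S_{1,2,2})`-free graphs with a cycle of length five have linear rank-width at
most `20`. -/
theorem hasWidth_of_not_pentaFree {V : Type*} [Fintype V] {G : SimpleGraph V} (hG : G.Connected)
    (ht : TriFree G) (hS : ClawFree G) (h5 : ¬ PentaFree G) : HasWidth G 20 := by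
  obtain ⟨v, hv, hmax⟩ := exists_max_penta h5
  have hP : ∀ i, IsPenta G (v i) (v (i + 1)) (v (i + 2)) (v (i + 3)) (v (i + 4)) := fun i => by
    have h1 := hv (i + 1)
    have h2 := hv (i + 2)
    have h3 := hv (i + 3)
    have h4 := hv (i + 4)
    simp only [zmod_five_add] at h1 h2 h3 h4
    exact ⟨hv i, h1, h2, h3, h4⟩
  let A : ZMod 5 → V → Prop := fun i => IsClone G (v (i + 4)) (v (i + 1))
  let B : ZMod 5 → V → Prop := fun i => IsPendant G (v i) (v (i + 2)) (v (i + 3))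
  have A1 : ∀ {i x}, A (i + 1) x → IsClone G (v i) (v (i + 2)) x := fun {i x} h => by
    simpa only [A, zmod_five_add] using h
  have A2 : ∀ {i x}, A (i + 2) x → IsClone G (v (i + 1)) (v (i + 3)) x := fun {i x} h => by
    simpa only [A, zmod_five_add] using h
  have A3 : ∀ {i x}, A (i + 3) x → IsClone G (v (i + 2)) (v (i + 4)) x := fun {i x} h => by
    simpa only [A, zmod_five_add] using h
  have A4 : ∀ {i x}, A (i + 4) x → IsClone G (v (i + 3)) (v i) x := fun {i x} h => by
    simpa only [A, zmod_five_add] using h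
  have B1 : ∀ {i x}, B (i + 1) x → IsPendant G (v (i + 1)) (v (i + 3)) (v (i + 4)) x :=
    fun {i x} h => by simpa only [B, zmod_five_add] using h
  have B2 : ∀ {i x}, B (i + 2) x → IsPendant G (v (i + 2)) (v (i + 4)) (v i) x :=
    fun {i x} h => by simpa only [B, zmod_five_add] using h
  have hcls : ∀ {u i}, G.Adj u (v i) → ∃ j, A j u ∨ B j u := fun {u i} h => by
    rcases clone_or_pendant (c := v (i + 2)) (d := v (i + 3)) h with h | h | h
    · exact ⟨i + 1, .inl (by simpa only [A, zmod_five_add] using h)⟩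
    · exact ⟨i + 4, .inl (by simpa only [A, zmod_five_add] using h)⟩
    · exact ⟨i, .inr h⟩
  have hdom : ∀ u, ∃ j, A j u ∨ B j u := by
    intro u
    have hr := (SimpleGraph.reachable_iff_reflTransGen (v 0) u).1 (hG.preconnected _ u)
    induction hr with
    | refl => exact hcls (hv 0)
    | @tail w u _ hwu ih =>
      obtain ⟨j, hj⟩ := ih
      by_contra hcon
      have hu : ∀ i, ¬ G.Adj u (v i) := fun i h => hcon (hcls h)
      rcases hj with h | h
      · exact (hP j).clone_dominating ht hS h (hu _) (hu _) (hu _) hwu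
      · exact (hP j).pendant_dominating ht hS h (hu _) (hu _) (hu _) hwu
  have AA : ∀ {i x y}, A i x → A i y → ¬ G.Adj x y := fun hx hy => ht.not_adj hx.1 hy.1.symm
  have AA2 : ∀ {i x y}, A i x → A (i + 2) y → ¬ G.Adj x y := fun hx hy =>
    ht.not_adj hx.2 (A2 hy).1.symm
  have AB1 : ∀ {i x y}, A i x → B (i + 1) y → ¬ G.Adj x y := fun hx hy => ht.not_adj hx.2 hy.1.symm
  have AB4 : ∀ {i x y}, A (i + 1) x → B i y → ¬ G.Adj x y := fun hx hy =>
    ht.not_adj (A1 hx).1 hy.1.symm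
  have AB : ∀ {i x y}, A i x → B i y → G.Adj x y := fun {i x y} hx hy =>
    (hP i).clone_adj_pendant ht hS hx hy
  have BB : ∀ {i x y}, B i x → B i y → ¬ G.Adj x y := fun hx hy => ht.not_adj hx.1 hy.1.symm
  have BB2 : ∀ {i x y}, B i x → B (i + 2) y → ¬ G.Adj x y := fun {i x y} hx hy =>
    (hP i).not_adj_pendant_pendant ht hS hx (B2 hy)
  have BB1 : ∀ {i x x' y}, B i x → B i x' → B (i + 1) y → G.Adj x y → G.Adj x' y :=
    fun {i x x' y} hx hx' hy h => (hP i).pendant_adj_pendant ht hS hx hx' (B1 hy) h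
  have BB4 : ∀ {i x x' y}, B (i + 1) x → B (i + 1) x' → B i y → G.Adj x y → G.Adj x' y :=
    fun {i x x' y} hx hx' hy h =>
      (hP i).rotate.reverse.pendant_adj_pendant ht hS (B1 hx).symm (B1 hx').symm hy.symm h
  have AAA : ∀ {i x y z}, A i x → A (i + 1) y → A (i + 2) z → G.Adj x y ∨ G.Adj y z :=
    fun {i x y z} hx hy hz => (hP i).clone_adj_or ht hS hx (A1 hy) (A2 hz)
  have BA2 : ∀ {i w x}, B i w → A (i + 2) x → G.Adj w x → ∃ y, A (i + 3) y ∧ ¬ G.Adj x y := by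
    intro i w x hw hx h
    obtain ⟨y, hy, hxy⟩ := (hP i).exists_not_adj ht hS (by
      have := hmax (i + 2)
      simpa only [zmod_five_add] using this) hw (A2 hx) h
    exact ⟨y, by simpa only [A, zmod_five_add] using hy, hxy⟩
  have BA3 : ∀ {i w x}, B i w → A (i + 3) x → G.Adj w x → ∃ y, A (i + 2) y ∧ ¬ G.Adj x y := by
    intro i w x hw hx h
    obtain ⟨y, hy, hxy⟩ := (hP i).reverse.exists_not_adj ht hS (fun z hz => by
      have := hmax (i + 3) z
      simp only [zmod_five_add] at this
      exact this hz.symm) hw.symm (A3 hx).symm h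
    exact ⟨y, by simpa only [A, zmod_five_add] using hy.symm, hxy⟩
  -- Block `i` holds the pendants at `i` and the clones of `i + 2` and `i + 3` that miss a clone of
  -- the other kind. The label `none` marks clones complete to both neighbouring clone classes.
  let Lab : V → ZMod 5 × Option (ZMod 3) → Prop := fun u l =>
    (∃ i, l = (i, some 0) ∧ B i u) ∨
    (∃ i, l = (i, some 1) ∧ A (i + 2) u ∧ ∃ y, A (i + 3) y ∧ ¬ G.Adj u y) ∨
    (∃ i, l = (i, some 2) ∧ A (i + 3) u ∧ ∃ y, A (i + 2) y ∧ ¬ G.Adj u y) ∨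
    (∃ i, l = (i, none) ∧ A i u ∧ (∀ y, A (i + 1) y → G.Adj u y) ∧ ∀ y, A (i + 4) y → G.Adj u y)
  have hLab : ∀ u, ∃ l, Lab u l := by
    intro u
    obtain ⟨j, h | h⟩ := hdom u
    · by_cases h1 : ∀ y, A (j + 1) y → G.Adj u y
      · by_cases h2 : ∀ y, A (j + 4) y → G.Adj u y
        · exact ⟨_, .inr (.inr (.inr ⟨j, rfl, h, h1, h2⟩))⟩
        · push Not at h2
          refine ⟨_, .inr (.inr (.inl ⟨j + 2, rfl, ?_⟩))⟩
          simpa only [zmod_five_add] using ⟨h, h2⟩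
      · push Not at h1
        refine ⟨_, .inr (.inl ⟨j + 3, rfl, ?_⟩)⟩
        simpa only [zmod_five_add] using ⟨h, h1⟩
    · exact ⟨_, .inl ⟨j, rfl, h⟩⟩
  choose l hl using hLab
  have inv0 : ∀ {u i}, l u = (i, some 0) → B i u := by
    intro u i h
    rcases hl u with ⟨j, hj, h'⟩ | ⟨j, hj, h'⟩ | ⟨j, hj, h'⟩ | ⟨j, hj, h'⟩ <;> rw [h] at hj <;>
      simp only [Prod.mk.injEq] at hj
    · exact hj.1 ▸ h'
    · exact absurd hj.2 (by decide)
    · exact absurd hj.2 (by decide)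
    · exact absurd hj.2 (by decide)
  have inv1 : ∀ {u i}, l u = (i, some 1) → A (i + 2) u ∧ ∃ y, A (i + 3) y ∧ ¬ G.Adj u y := by
    intro u i h
    rcases hl u with ⟨j, hj, h'⟩ | ⟨j, hj, h'⟩ | ⟨j, hj, h'⟩ | ⟨j, hj, h'⟩ <;> rw [h] at hj <;>
      simp only [Prod.mk.injEq] at hj
    · exact absurd hj.2 (by decide)
    · exact hj.1 ▸ h'
    · exact absurd hj.2 (by decide)
    · exact absurd hj.2 (by decide)
  have inv2 : ∀ {u i}, l u = (i, some 2) → A (i + 3) u ∧ ∃ y, A (i + 2) y ∧ ¬ G.Adj u y := by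
    intro u i h
    rcases hl u with ⟨j, hj, h'⟩ | ⟨j, hj, h'⟩ | ⟨j, hj, h'⟩ | ⟨j, hj, h'⟩ <;> rw [h] at hj <;>
      simp only [Prod.mk.injEq] at hj
    · exact absurd hj.2 (by decide)
    · exact absurd hj.2 (by decide)
    · exact hj.1 ▸ h'
    · exact absurd hj.2 (by decide)
  have inv3 : ∀ {u i}, l u = (i, none) → A i u ∧ (∀ y, A (i + 1) y → G.Adj u y) ∧
      ∀ y, A (i + 4) y → G.Adj u y := by
    intro u i h
    rcases hl u with ⟨j, hj, h'⟩ | ⟨j, hj, h'⟩ | ⟨j, hj, h'⟩ | ⟨j, hj, h'⟩ <;> rw [h] at hj <;>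
      simp only [Prod.mk.injEq] at hj
    · exact absurd hj.2 (by decide)
    · exact absurd hj.2 (by decide)
    · exact absurd hj.2 (by decide)
    · exact hj.1 ▸ h'
  have hcase : ∀ u, (∃ i, l u = (i, some 0)) ∨ ∃ j, ∀ u', l u = l u' → A j u' ∧
      (l u ≠ (j + 3, some 1) → ∀ y, A (j + 1) y → G.Adj u' y) ∧
      (l u ≠ (j + 2, some 2) → ∀ y, A (j + 4) y → G.Adj u' y) := by
    intro u
    rcases hl u with ⟨j, hj, -⟩ | ⟨j, hj, -⟩ | ⟨j, hj, -⟩ | ⟨j, hj, -⟩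
    · exact .inl ⟨j, hj⟩
    · refine .inr ⟨j + 2, fun u' hu' => ?_⟩
      obtain ⟨h1, y, hy, hxy⟩ := inv1 (hu'.symm.trans hj)
      refine ⟨h1, fun h => absurd hj (by simpa only [zmod_five_add] using h), fun _ z hz => ?_⟩
      simp only [zmod_five_add] at hz
      have := AAA (i := j + 1) hz (by simpa only [zmod_five_add] using h1)
        (by simpa only [zmod_five_add] using hy)
      exact (this.resolve_right hxy).symm
    · refine .inr ⟨j + 3, fun u' hu' => ?_⟩
      obtain ⟨h1, y, hy, hxy⟩ := inv2 (hu'.symm.trans hj)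
      refine ⟨h1, fun _ z hz => ?_, fun h => absurd hj (by simpa only [zmod_five_add] using h)⟩
      have := AAA (i := j + 2) hy (by simpa only [zmod_five_add] using h1)
        (by simpa only [zmod_five_add] using hz)
      exact this.resolve_left fun h => hxy h.symm
    · exact .inr ⟨j, fun u' hu' =>
        have h := inv3 (hu'.symm.trans hj)
        ⟨h.1, fun _ => h.2.1, fun _ => h.2.2⟩⟩
  -- Edges between pendants at `i` and clones of other vertices reach only defective clones of `i +
  -- 2` and `i + 3`; this is where maximality of the degrees enters.
  have hBA : ∀ {i j w x}, B i w → A j x → G.Adj w x → j = i ∨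
      j = i + 2 ∧ (∃ y, A (j + 1) y ∧ ¬ G.Adj x y) ∨ j = i + 3 ∧ ∃ y, A (j + 4) y ∧ ¬ G.Adj x y := by
    intro i j w x hw hx h
    rcases zmod_five_cases i j with rfl | rfl | rfl | rfl | rfl
    · exact .inl rfl
    · exact absurd h.symm (AB4 hx hw)
    · refine .inr (.inl ⟨rfl, ?_⟩)
      simpa only [zmod_five_add] using BA2 hw hx h
    · refine .inr (.inr ⟨rfl, ?_⟩)
      simpa only [zmod_five_add] using BA3 hw hx h
    · exact absurd h.symm (AB1 hx (by simpa only [zmod_five_add] using hw))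
  refine HasWidth.of_blocks ht l (fun x x' y hxx' hxy hexc => ?_) (fun b w x y hw hx hy => ?_)
    fun b k u u' y y' hu hu' hy hy' h h' => ?_
  · rcases hcase x with ⟨i, hx⟩ | ⟨i, hx⟩ <;> rcases hcase y with ⟨j, hy⟩ | ⟨j, hy⟩
    · have bx := inv0 hx
      have bx' := inv0 (hxx'.symm.trans hx)
      have bY := inv0 hy
      rcases zmod_five_cases i j with rfl | rfl | rfl | rfl | rfl
      · exact absurd hxy (BB bx bY)
      · exact BB1 bx bx' bY hxy
      · exact absurd hxy (BB2 bx bY)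
      · exact absurd hxy.symm (BB2 bY (by simpa only [zmod_five_add] using bx))
      · exact BB4 (i := i + 4) (by simpa only [zmod_five_add] using bx)
          (by simpa only [zmod_five_add] using bx') bY hxy
    · have bx := inv0 hx
      have bx' := inv0 (hxx'.symm.trans hx)
      obtain ⟨hA, h1, h2⟩ := hy y rfl
      rcases hBA bx hA hxy with rfl | ⟨rfl, z, hz, hyz⟩ | ⟨rfl, z, hz, hyz⟩
      · exact (AB hA bx').symm
      · refine absurd (h1 ?_ z hz) hyz
        simpa only [zmod_five_add] using hexc i 0 1 (by decide) hx
      · refine absurd (h2 ?_ z hz) hyz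
        simpa only [zmod_five_add] using hexc i 0 2 (by decide) hx
    · obtain ⟨hA, h1, h2⟩ := hx x rfl
      obtain ⟨hA', -, -⟩ := hx x' hxx'
      have bY := inv0 hy
      rcases hBA bY hA hxy.symm with rfl | ⟨rfl, z, hz, hyz⟩ | ⟨rfl, z, hz, hyz⟩
      · exact AB hA' bY
      · refine absurd (h1 (fun hl' => ?_) z hz) hyz
        simp only [zmod_five_add] at hl'
        exact hexc j 1 0 (by decide) hl' hy
      · refine absurd (h2 (fun hl' => ?_) z hz) hyz
        simp only [zmod_five_add] at hl'
        exact hexc j 2 0 (by decide) hl' hy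
    · obtain ⟨hA, -, -⟩ := hx x rfl
      obtain ⟨hA', h1', h2'⟩ := hx x' hxx'
      obtain ⟨hAy, h1, h2⟩ := hy y rfl
      rcases zmod_five_cases i j with rfl | rfl | rfl | rfl | rfl
      · exact absurd hxy (AA hA hAy)
      -- If `x` has the defect towards clones of `i + 1`, then `y`, not being in another part of
      -- that block, is complete to the clones of `i`.
      · by_cases hlx : l x = (i + 3, some 1)
        · refine (h2 ?_ x' ?_).symm
          · simpa only [zmod_five_add] using hexc _ 1 2 (by decide) hlx
          · simpa only [zmod_five_add] using hA'
        · exact h1' hlx y hAy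
      · exact absurd hxy (AA2 hA hAy)
      · exact absurd hxy.symm (AA2 hAy (by simpa only [zmod_five_add] using hA))
      · by_cases hlx : l x = (i + 2, some 2)
        · refine (h1 ?_ x' ?_).symm
          · simpa only [zmod_five_add] using hexc _ 2 1 (by decide) hlx
          · simpa only [zmod_five_add] using hA'
        · exact h2' hlx y hAy
  · exact (hP b).pendant_triple ht hS (inv0 hw) (A2 (inv1 hx).1) (A3 (inv2 hy).1)
  · have : k = 0 ∨ k = 1 ∨ k = 2 := by
      clear hu hu' hy hy'
      decide +revert
    rcases this with rfl | rfl | rfl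
    · exact (hP b).pendant_chain ht hS (inv0 hu) (inv0 hu') (A2 (inv1 hy).1) (A2 (inv1 hy').1) h h'
    · exact (hP b).rotate.rotate.clone_chain ht hS (A2 (inv1 hu).1) (A2 (inv1 hu').1)
        (A3 (inv2 hy).1) (A3 (inv2 hy').1) h h'
    · have := (hP b).reverse.pendant_chain ht hS (inv0 hy).symm (inv0 hy').symm
        (A3 (inv2 hu).1).symm (A3 (inv2 hu').1).symm h.symm h'.symm
      rcases this with h3 | h3
      · exact .inr h3.symm
      · exact .inl h3.symm

end LinearRankWidth

theorem theorem1p10 {V : Type*} [Fintype V] (G : SimpleGraph V)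
    (hK : LinearRankWidth.InducedFree (SimpleGraph.completeGraph (Fin 3)) G)
    (hS : LinearRankWidth.InducedFree (LinearRankWidth.subdividedClaw ![1, 2, 2]) G) :
    LinearRankWidth.linearRankWidth G ≤ 58 ∧
    (G.IsBipartite → LinearRankWidth.linearRankWidth G ≤ 3) ∧
    (¬ G.IsBipartite → LinearRankWidth.InducedFree (SimpleGraph.cycleGraph 5) G →
      LinearRankWidth.linearRankWidth G ≤ 3) := by
  classical
  open LinearRankWidth in
  have ht := TriFree.of_inducedFree hK
  have hcl := ClawFree.of_inducedFree ht hS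
  have emb : ∀ C : G.ConnectedComponent, C.toSimpleGraph ↪g G := fun C =>
    SimpleGraph.Embedding.induce _
  refine ⟨?_, fun hb => ?_, fun _ h => ?_⟩
  · refine (HasWidth.of_components fun C => ?_).linearRankWidth_le
    by_cases h5 : PentaFree C.toSimpleGraph
    · exact (hasWidth_of_pentaFree C.connected_toSimpleGraph (ht.comap (emb C))
        (hcl.comap (emb C)) (.inr h5)).mono (by omega)
    · exact (hasWidth_of_not_pentaFree C.connected_toSimpleGraph (ht.comap (emb C))
        (hcl.comap (emb C)) h5).mono (by omega)
  · refine (HasWidth.of_components fun C => ?_).linearRankWidth_le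
    exact hasWidth_of_pentaFree C.connected_toSimpleGraph (ht.comap (emb C))
      (hcl.comap (emb C)) (.inl (hb.of_hom (emb C).toHom))
  · refine (HasWidth.of_components fun C => ?_).linearRankWidth_le
    exact hasWidth_of_pentaFree C.connected_toSimpleGraph (ht.comap (emb C))
      (hcl.comap (emb C)) (.inr ((PentaFree.of_inducedFree ht h).comap (emb C)))
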